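/- **Conventions.** Let $K$ be an abstract elementary class (AEC) with ordering $\prec$, and let $\lambda\ge \mathrm{LS}(K)$ be a cardinal with $K_\lambda\neq\emptyset$, where $K_\lambda=\{M\in K:\|M\|=\lambda\}$. A $K$-embedding $f:M\to N$ is an isomorphism of $M$ onto some $f[M]\prec N$. $S^\beta(M)$ is the set of Galois types $\mathrm{tp}(\bar a/M;N)$ of sequences $\bar a$ of length $\beta$ from extensions $N\succ M$ in $K$; $p^\gamma\restriction M'$ is the restriction of $p\in S^\beta(M)$ to the first $\gamma\le\beta$ coordinates and to $M'\prec M$. A type is nonalgebraic if no coordinate of a realization lies in its domain. Chains of models and of ordinals are increasing in the weak sense. **Frames.** Let $\alpha$ be an ordinal. A *pre-$(<\alpha,\lambda)$-frame* on $K$ is a class $S^{bs}$ of nonalgebraic ("basic") types of sequences of length $<\alpha$ over models in $K_\lambda$, with a relation "$\bar a$ is free from $M_1$ over $M_0$ in $N$" ($M_0\prec M_1\prec N$ in $K_\lambda$, $\bar a$ a sequence of length $<\alpha$ in $N$), such that: * both are invariant under isomorphisms; * if $\bar a$ is free from $M_1$ over $M_0$ in $N$, $\bar a'$ is a subsequence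 of $\bar a$, and $M_0\prec M_0'\prec M_1'\prec M_1\prec N'\prec N\prec N''$ are in $K_\lambda$ with $\bar a'$ in $N'$, then $\bar a'$ is free from $M_1'$ over $M_0'$ in $N'$ and in $N''$; the type of a subsequence of a realization of a basic type is basic; * if $\bar a$ is free from $M$ over $M$ in $N$, then $\mathrm{tp}(\bar a/M;N)\in S^{bs}$. A type $p$ over $M_1$ *does not fork over* $M_0$ if $p=\mathrm{tp}(\bar a/M_1;N)$ for some $\bar a,N$ with $\bar a$ free from $M_1$ over $M_0$ in $N$. Write $S^{bs}_\beta(M)$ for the basic types of length $\beta$ over $M$. The frame is $\text{good}^{-St}$ (good, except possibly for stability of basic types) if moreover, with all models in $K_\lambda$ and all lengths $<\alpha$: 1. $K_\lambda$ has amalgamation, joint embedding and no maximal models. 2. (Density) If $M\prec N$, $M\ne N$, then $\mathrm{tp}(a/M;N)$ is basic for some $a\in N$. 3. (Existence) If $p\in S^{bs}_\gamma(M)$, $M\prec N$ and $\gamma\le\beta<\alpha$, there is $q\in S^{bs}_\beta(N)$ that does not fork over $M$ with $q^\gamma\restriction M=p$. 4. (Uniqueness) If $p,q\in S^{\beta}(N)$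 do not fork over $M$ and $p\restriction M=q\restriction M$, then $p=q$. 5. (Symmetry) If $\bar a_1$ is free from $M_2$ over $M_0$ in $N$, $\bar a_2$ is in $M_2$ and $\mathrm{tp}(\bar a_2/M_0;N)$ is basic, then there are $N'\succ N$ and $M_1\prec N'$ containing $\bar a_1$ such that $\bar a_2$ is free from $M_1$ over $M_0$ in $N'$. 6. (Local character) If $\delta$ is a limit ordinal, $\langle M_i:i\le\delta\rangle$ is increasing continuous and $p\in S^{bs}_\beta(M_\delta)$ with $\beta<\mathrm{cf}(\delta)$, then $p$ does not fork over $M_i$ for some $i<\delta$. 7. (Continuity) If $\delta$ is a limit ordinal, $\langle M_i:i\le\delta\rangle$ and $\langle \alpha_i<\alpha:i\le\delta\rangle$ are increasing continuous, and $p_i\in S^{bs}_{\alpha_i}(M_i)$ for $i<\delta$ satisfy $p_j=p_i^{\alpha_j}\restriction M_j$ for $j<i$, then some $p\in S^{bs}_{\alpha_\delta}(M_\delta)$ satisfies $p^{\alpha_i}\restriction M_i=p_i$ for all $i<\delta$. Moreover, if no $p_i$ forks over $M_0$, then any $p\in S^{\alpha_\delta}(M_\delta)$ with $p^{\alpha_i}\restriction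 M_i=p_i$ for all $i<\delta$ does not fork over $M_0$. 8. (Transitivity) If $M_0\prec M_1\prec M_2$, $p\in S^\beta(M_2)$ does not fork over $M_1$ and $p\restriction M_1$ does not fork over $M_0$, then $p$ does not fork over $M_0$. A *$\text{good}^{-St}$ $\lambda$-frame* is a $\text{good}^{-St}$ $(<2,\lambda)$-frame (types of length at most one). **Independence.** Let $\mathfrak s$ be a pre-$(<2,\lambda)$-frame and $M\prec M_0\prec N$ in $K_\lambda$. A sequence $\langle a_i:i<\beta\rangle$ in $N$ is *independent from $M_0$ over $M$ in $N$* if there are $N^+\succ N$ in $K_\lambda$ and an increasing continuous $\langle M^i:i\le\beta\rangle$ in $K_\lambda$ with $M_0\prec M^0$, $M^\beta\prec N^+$, such that for all $i<\beta$, $a_i\in M^{i+1}$ and $a_i$ is free from $M^i$ over $M$ in $M^{i+1}$. A set is independent from $M_0$ over $M$ in $N$ if some enumeration of it is. In $\mathfrak s^{<\lambda^+}$, "$\bar a$ is free from $M_1$ over $M_0$ in $N$" means that $\bar a$ has length $<\lambda^+$ and is independent from $M_1$ over $M_0$ in $N$, and the basic types over $M$ are those $\mathrm{tp}(\bar a/M;N)$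 with $\bar a$ of length $<\lambda^+$ independent from $M$ over $M$ in $N$. **Corollary.** Let $\mathfrak s$ be a $\text{good}^{-St}$ $\lambda$-frame such that $\mathfrak s^{<\lambda^+}$ has symmetry (condition 5, for sequences of length $<\lambda^+$). Let $M\prec M_0\prec N$ be in $K_\lambda$ and $P\subseteq S^{bs}_1(M_0)$. Let $I_1,I_2$ be $\subseteq$-maximal elements of $$\{I\subseteq N : I\text{ is independent from }M_0\text{ over }M\text{ in }N,\text{ and }\mathrm{tp}(a/M_0;N)\in P\text{ for all }a\in I\}.$$ If $I_1$ or $I_2$ is infinite, then both are infinite and $|I_1|=|I_2|$. -/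

import Mathlib

open FirstOrder FirstOrder.Language Cardinal

universe u

/-! ### Abstract elementary classes -/

/-- An abstract elementary class in the language `L`.  `Mem M` says that the structure `M` belongs
to the class; `Strong N S` says that the substructure `S` of `N` satisfies `S ≺ N`. -/
structure AEC (L : FirstOrder.Language.{u, u}) where
  Mem : (M : Type u) → [L.Structure M] → Prop
  Strong : (N : Type u) → [L.Structure N] → L.Substructure N → Prop
  /-- `≺` is a relation between members of the class. -/
  mem_of_strong : ∀ {N : Type u} [L.Structure N] {S : L.Substructure N},
    Strong N S → Mem S ∧ Mem N
  /-- Closure under isomorphism, of the class and of `≺`. -/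
  mem_of_equiv : ∀ {M N : Type u} [L.Structure M] [L.Structure N], (M ≃[L] N) → Mem M → Mem N
  strong_of_equiv : ∀ {N N' : Type u} [L.Structure N] [L.Structure N'] (f : N ≃[L] N')
    {S : L.Substructure N}, Strong N S → Strong N' (S.map f.toHom)
  /-- `≺` is reflexive and transitive. -/
  strong_top : ∀ {N : Type u} [L.Structure N], Mem N → Strong N ⊤
  strong_trans : ∀ {N : Type u} [L.Structure N] {S : L.Substructure N} {T : L.Substructure S},
    Strong N S → Strong S T → Strong N (T.map S.subtype.toHom)
  /-- Coherence: if `T ⊆ S ⊆ N`, `S ≺ N` and `T ≺ N`, then `T ≺ S`. -/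
  coherence : ∀ {N : Type u} [L.Structure N] {S : L.Substructure N} {T : L.Substructure S},
    Strong N S → Strong N (T.map S.subtype.toHom) → Strong S T
  /-- Tarski–Vaught chain axioms: the union `A` of a nonempty `≺`-chain `c` is in the class and is
  a `≺`-extension of each member of the chain. -/
  chain_union : ∀ {A : Type u} [L.Structure A] (c : Set (L.Substructure A)), c.Nonempty →
    IsChain (· ≤ ·) c →
    (∀ S ∈ c, ∀ T ∈ c, S ≤ T → Strong T (S.comap T.subtype.toHom)) →
    (∀ x : A, ∃ S ∈ c, x ∈ S) →
    Mem A ∧ ∀ S ∈ c, Strong A S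
  /-- Smoothness: if all the members of a nonempty chain are `≺ N`, then so is the union. -/
  chain_smooth : ∀ {N : Type u} [L.Structure N] (c : Set (L.Substructure N)), c.Nonempty →
    IsChain (· ≤ ·) c → (∀ S ∈ c, Strong N S) → Strong N (sSup c)
  /-- The Löwenheim–Skolem–Tarski axiom. -/
  exists_ls : ∃ μ : Cardinal.{u}, ℵ₀ ≤ μ ∧ L.card ≤ μ ∧
    ∀ (N : Type u) [L.Structure N], Mem N → ∀ A : Set N, ∃ S : L.Substructure N,
      Strong N S ∧ A ⊆ S ∧ #S ≤ #A + μ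

namespace AEC

variable {L : FirstOrder.Language.{u, u}} (K : AEC L)

/-- The Löwenheim–Skolem–Tarski number `LS(K)`: the least cardinal as in the axiom. -/
noncomputable def LS : Cardinal.{u} :=
  sInf {μ : Cardinal.{u} | ℵ₀ ≤ μ ∧ L.card ≤ μ ∧
    ∀ (N : Type u) [L.Structure N], K.Mem N → ∀ A : Set N, ∃ S : L.Substructure N,
      K.Strong N S ∧ A ⊆ S ∧ #S ≤ #A + μ}

/-- `M ∈ K_κ`. -/
def MemCard (κ : Cardinal.{u}) (M : Type u) [L.Structure M] : Prop := K.Mem M ∧ #M = κ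

/-- `S ≺ N` with `S, N ∈ K_κ`. -/
def StrongCard (κ : Cardinal.{u}) (N : Type u) [L.Structure N] (S : L.Substructure N) : Prop :=
  K.Strong N S ∧ #S = κ ∧ #N = κ

/-- `f` is a `K`-embedding: `f[M] ≺ N`. -/
def IsEmb {M N : Type u} [L.Structure M] [L.Structure N] (f : M ↪[L] N) : Prop :=
  K.Strong N f.toHom.range

variable {K}

theorem isEmb_comp {M N P : Type u} [L.Structure M] [L.Structure N] [L.Structure P]
    {g : N ↪[L] P} {f : M ↪[L] N} (hg : K.IsEmb g) (hf : K.IsEmb f) : K.IsEmb (g.comp f) := by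
  have h1 := K.strong_trans hg (K.strong_of_equiv g.equivRange hf)
  have : (f.toHom.range.map g.equivRange.toHom).map g.toHom.range.subtype.toHom
      = (g.comp f).toHom.range := by
    ext x
    simp [Substructure.mem_map, Hom.mem_range]
  rw [this] at h1
  exact h1

theorem isEmb_subtype {N : Type u} [L.Structure N] {S : L.Substructure N} (h : K.Strong N S) :
    K.IsEmb S.subtype := by
  unfold IsEmb
  rwa [Substructure.range_subtype]

theorem isEmb_inclusion {N : Type u} [L.Structure N] {S T : L.Substructure N} (hST : S ≤ T)
    (hS : K.Strong N S) (hT : K.Strong N T) : K.IsEmb (Substructure.inclusion hST) := by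
  refine K.coherence hT ?_
  have : (Substructure.inclusion hST).toHom.range.map T.subtype.toHom = S := by
    ext x
    simp only [Substructure.mem_map, Hom.mem_range]
    constructor
    · rintro ⟨_, ⟨y, rfl⟩, rfl⟩
      exact y.2
    · intro hx
      exact ⟨Substructure.inclusion hST ⟨x, hx⟩, ⟨⟨x, hx⟩, rfl⟩, rfl⟩
  rwa [this]

variable (K)

/-- `K_κ` has amalgamation. -/
def Amalgamation (κ : Cardinal.{u}) : Prop :=
  ∀ (M₀ M₁ M₂ : Type u) [L.Structure M₀] [L.Structure M₁] [L.Structure M₂]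
    (e₁ : M₀ ↪[L] M₁) (e₂ : M₀ ↪[L] M₂), K.MemCard κ M₀ → K.MemCard κ M₁ → K.MemCard κ M₂ →
    K.IsEmb e₁ → K.IsEmb e₂ →
    ∃ (N : Type u) (_ : L.Structure N) (f₁ : M₁ ↪[L] N) (f₂ : M₂ ↪[L] N),
      K.MemCard κ N ∧ K.IsEmb f₁ ∧ K.IsEmb f₂ ∧ ∀ m, f₁ (e₁ m) = f₂ (e₂ m)

/-- `K_κ` has joint embedding. -/
def JointEmbedding (κ : Cardinal.{u}) : Prop :=
  ∀ (M₁ M₂ : Type u) [L.Structure M₁] [L.Structure M₂], K.MemCard κ M₁ → K.MemCard κ M₂ →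
    ∃ (N : Type u) (_ : L.Structure N) (f₁ : M₁ ↪[L] N) (f₂ : M₂ ↪[L] N),
      K.MemCard κ N ∧ K.IsEmb f₁ ∧ K.IsEmb f₂

/-- `K_κ` has no maximal models. -/
def NoMaximalModels (κ : Cardinal.{u}) : Prop :=
  ∀ (M : Type u) [L.Structure M], K.MemCard κ M →
    ∃ (N : Type u) (_ : L.Structure N) (f : M ↪[L] N),
      K.MemCard κ N ∧ K.IsEmb f ∧ ¬ Function.Surjective f

/-- `⟨C i : i ≤ δ⟩` is an increasing continuous sequence of models in `K_κ`, all of them `≺ N`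
(so that `C i ≺ C j` for `i ≤ j` by coherence). Values at indices above `δ` are irrelevant. -/
def IncrCont (κ : Cardinal.{u}) {N : Type u} [L.Structure N] (δ : Ordinal.{u})
    (C : Ordinal.{u} → L.Substructure N) : Prop :=
  (∀ i ≤ δ, K.Strong N (C i) ∧ #(C i) = κ) ∧
  (∀ i j, i ≤ j → j ≤ δ → C i ≤ C j) ∧
  (∀ j ≤ δ, Order.IsSuccLimit j → ∀ x : N, x ∈ C j ↔ ∃ i < j, x ∈ C i)

/-! ### Galois types -/

/-- Sequences of length `β` in `N`. -/
abbrev Seq (β : Ordinal.{u}) (N : Type u) := Set.Iio β → N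

/-- The sequence of length one with entry `a`. -/
def single {N : Type u} (a : N) : Seq 1 N := fun _ => a

/-- The initial segment of length `γ` of a sequence of length `β`. -/
def Seq.init {N : Type u} {γ β : Ordinal.{u}} (h : γ ≤ β) (a : Seq β N) : Seq γ N :=
  fun i => a ⟨i.1, lt_of_lt_of_le i.2 h⟩

/-- A triple `(ā, M, N)` with `M ≺ N ∈ K` and `ā` a sequence of length `β` in `N`; the extension
`N` of `M` is presented by a `K`-embedding of `M` into `N`. -/
structure Triple (M : Type u) [L.Structure M] (β : Ordinal.{u}) where
  carrier : Type u
  [str : L.Structure carrier]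
  emb : M ↪[L] carrier
  isEmb : K.IsEmb emb
  seq : Seq β carrier

attribute [instance] Triple.str

/-- Atomic equivalence of triples: the two extensions embed over `M` in a common extension that
identifies the two sequences. -/
def AtomicEquiv {M : Type u} [L.Structure M] {β : Ordinal.{u}} (t t' : K.Triple M β) : Prop :=
  ∃ (N : Type u) (_ : L.Structure N) (f : t.carrier ↪[L] N) (f' : t'.carrier ↪[L] N),
    K.IsEmb f ∧ K.IsEmb f' ∧ (∀ m, f (t.emb m) = f' (t'.emb m)) ∧
      ∀ i, f (t.seq i) = f' (t'.seq i)

/-- `S^β(M)`: Galois types of sequences of length `β` over `M`, the classes of the equivalence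
relation generated by atomic equivalence. -/
def GType (M : Type u) [L.Structure M] (β : Ordinal.{u}) : Type (u + 1) :=
  Quot (K.AtomicEquiv (M := M) (β := β))

variable {K}

/-- `tp(ā / M; N)`, where `N` extends `M` via the `K`-embedding `e`. -/
def tp {M N : Type u} [L.Structure M] [L.Structure N] (e : M ↪[L] N) (he : K.IsEmb e)
    {β : Ordinal.{u}} (a : Seq β N) : K.GType M β :=
  Quot.mk _ ⟨N, e, he, a⟩

/-- `tp(ā / S; N)` for `S ≺ N`. -/
def tpIn {N : Type u} [L.Structure N] {S : L.Substructure N} (h : K.Strong N S)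
    {β : Ordinal.{u}} (a : Seq β N) : K.GType S β :=
  tp S.subtype (isEmb_subtype h) a

/-- `p^γ ↾ M₀`, for `p` a type of length `β ≥ γ` over an extension `M` of `M₀`. -/
def GType.restrict {M₀ M : Type u} [L.Structure M₀] [L.Structure M] (e : M₀ ↪[L] M)
    (he : K.IsEmb e) {γ β : Ordinal.{u}} (h : γ ≤ β) (p : K.GType M β) : K.GType M₀ γ :=
  Quot.map (fun t => ⟨t.carrier, t.emb.comp e, isEmb_comp t.isEmb he, t.seq.init h⟩)
    (by
      rintro t t' ⟨N, _, f, f', hf, hf', h1, h2⟩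
      exact ⟨N, _, f, f', hf, hf', fun m => h1 (e m), fun i => h2 _⟩) p

/-- `p` is nonalgebraic: no entry of a realization lies in the domain. -/
def GType.Nonalg {M : Type u} [L.Structure M] {β : Ordinal.{u}} (p : K.GType M β) : Prop :=
  ∃ t : K.Triple M β, p = Quot.mk _ t ∧ ∀ i, t.seq i ∉ t.emb.toHom.range

end AEC

/-! ### Frames -/

/-- The data of a frame on `K`: `nf M₀ M₁ a` (for `M₀, M₁` substructures of `N`) says that
`a` is free from `M₁` over `M₀` in `N`; `bs M β` is the set of basic types of length `β` over `M`. -/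
structure FrameData {L : FirstOrder.Language.{u, u}} (K : AEC L) where
  nf : ∀ {N : Type u} [L.Structure N] (_M₀ _M₁ : L.Substructure N) {β : Ordinal.{u}}
    (_a : AEC.Seq β N), Prop
  bs : ∀ (M : Type u) [L.Structure M] (β : Ordinal.{u}), Set (K.GType M β)

namespace FrameData

open AEC

variable {L : FirstOrder.Language.{u, u}} {K : AEC L} (s : FrameData K)

/-- The type `p` over `M` does not fork over `M₀`. -/
def DNF {M : Type u} [L.Structure M] (M₀ : L.Substructure M) {β : Ordinal.{u}}
    (p : K.GType M β) : Prop :=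
  ∃ (N : Type u) (_ : L.Structure N) (e : M ↪[L] N) (he : K.IsEmb e) (a : Seq β N),
    p = tp e he a ∧ s.nf (M₀.map e.toHom) e.toHom.range a

/-- `s` is a pre-`(<α, κ)`-frame. -/
structure IsPreFrame (α : Ordinal.{u}) (κ : Cardinal.{u}) : Prop where
  ls_le : K.LS ≤ κ
  nonempty : ∃ (M : Type u) (_ : L.Structure M), K.MemCard κ M
  bs_dom : ∀ (M : Type u) [L.Structure M] (β : Ordinal.{u}), ∀ p ∈ s.bs M β,
    K.MemCard κ M ∧ β < α ∧ p.Nonalg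
  nf_dom : ∀ {N : Type u} [L.Structure N] (M₀ M₁ : L.Substructure N) {β : Ordinal.{u}}
    (a : Seq β N), s.nf M₀ M₁ a →
    K.StrongCard κ N M₀ ∧ K.StrongCard κ N M₁ ∧ M₀ ≤ M₁ ∧ β < α
  nf_invariance : ∀ {N N' : Type u} [L.Structure N] [L.Structure N'] (f : N ≃[L] N')
    (M₀ M₁ : L.Substructure N) {β : Ordinal.{u}} (a : Seq β N), s.nf M₀ M₁ a →
    s.nf (M₀.map f.toHom) (M₁.map f.toHom) (fun i => f (a i))
  /-- Here `N ≅ N'` carries the copy of `M` in `N` onto the copy of `M'` in `N'`. -/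
  bs_invariance : ∀ {M N M' N' : Type u} [L.Structure M] [L.Structure N] [L.Structure M']
    [L.Structure N'] (e : M ↪[L] N) (he : K.IsEmb e) (e' : M' ↪[L] N') (he' : K.IsEmb e')
    (g : M ≃[L] M') (f : N ≃[L] N'), (∀ m, f (e m) = e' (g m)) →
    ∀ {β : Ordinal.{u}} (a : Seq β N), tp e he a ∈ s.bs M β →
      tp e' he' (fun i => f (a i)) ∈ s.bs M' β
  /-- Monotonicity: passing to a subsequence, enlarging the base, shrinking the right side, and
  shrinking or enlarging the ambient model. -/
  nf_mono_sub : ∀ {N : Type u} [L.Structure N] (M₀ M₁ M₀' M₁' N' : L.Substructure N)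
    {β β' : Ordinal.{u}} (a : Seq β N) (ρ : Set.Iio β' → Set.Iio β), StrictMono ρ →
    s.nf M₀ M₁ a → M₀ ≤ M₀' → M₀' ≤ M₁' → M₁' ≤ M₁ → M₁ ≤ N' →
    K.StrongCard κ N M₀' → K.StrongCard κ N M₁' → K.StrongCard κ N N' →
    ∀ ha : ∀ i, a (ρ i) ∈ N',
      s.nf (M₀'.comap N'.subtype.toHom) (M₁'.comap N'.subtype.toHom)
        (fun i => (⟨a (ρ i), ha i⟩ : N'))
  nf_mono_ext : ∀ {N N'' : Type u} [L.Structure N] [L.Structure N'']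
    (M₀ M₁ M₀' M₁' : L.Substructure N) {β β' : Ordinal.{u}} (a : Seq β N)
    (ρ : Set.Iio β' → Set.Iio β), StrictMono ρ →
    s.nf M₀ M₁ a → M₀ ≤ M₀' → M₀' ≤ M₁' → M₁' ≤ M₁ →
    K.StrongCard κ N M₀' → K.StrongCard κ N M₁' →
    ∀ h : N ↪[L] N'', K.IsEmb h → K.MemCard κ N'' →
      s.nf (M₀'.map h.toHom) (M₁'.map h.toHom) (fun i => h (a (ρ i)))
  bs_mono : ∀ {M N : Type u} [L.Structure M] [L.Structure N] (e : M ↪[L] N) (he : K.IsEmb e)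
    {β β' : Ordinal.{u}} (a : Seq β N) (ρ : Set.Iio β' → Set.Iio β), StrictMono ρ →
    tp e he a ∈ s.bs M β → tp e he (fun i => a (ρ i)) ∈ s.bs M β'
  /-- Nonforking types are basic. -/
  bs_of_nf : ∀ {N : Type u} [L.Structure N] (M : L.Substructure N) (hM : K.Strong N M)
    {β : Ordinal.{u}} (a : Seq β N), s.nf M M a → tpIn hM a ∈ s.bs M β

/-- Density of basic types. -/
def Density (κ : Cardinal.{u}) : Prop :=
  ∀ (N : Type u) [L.Structure N] (M : L.Substructure N) (hM : K.Strong N M),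
    K.StrongCard κ N M → M ≠ ⊤ → ∃ a : N, tpIn hM (single a) ∈ s.bs M 1

/-- Existence of nonforking extensions. -/
def Existence (α : Ordinal.{u}) (κ : Cardinal.{u}) : Prop :=
  ∀ (M N : Type u) [L.Structure M] [L.Structure N] (e : M ↪[L] N) (he : K.IsEmb e),
    K.MemCard κ M → K.MemCard κ N → ∀ (γ β : Ordinal.{u}) (h : γ ≤ β), β < α →
    ∀ p ∈ s.bs M γ, ∃ q ∈ s.bs N β, s.DNF e.toHom.range q ∧ q.restrict e he h = p

/-- Uniqueness of nonforking extensions. -/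
def Uniqueness (α : Ordinal.{u}) (κ : Cardinal.{u}) : Prop :=
  ∀ (N : Type u) [L.Structure N] (M : L.Substructure N) (hM : K.Strong N M),
    K.StrongCard κ N M → ∀ β < α, ∀ p q : K.GType N β, s.DNF M p → s.DNF M q →
    p.restrict M.subtype (isEmb_subtype hM) le_rfl =
      q.restrict M.subtype (isEmb_subtype hM) le_rfl → p = q

/-- Symmetry: if `a₁` is free from `M₂` over `M₀` in `N` and `a₂` in `M₂` has basic type over `M₀`,
then in some extension `N'` of `N` there is a model `M₁` containing `a₁` such that `a₂` is free
from `M₁` over `M₀`. -/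
def Symmetry (α : Ordinal.{u}) (κ : Cardinal.{u}) : Prop :=
  ∀ (N : Type u) [L.Structure N] (M₀ M₂ : L.Substructure N) (hM₀ : K.Strong N M₀)
    {β₁ β₂ : Ordinal.{u}} (a₁ : Seq β₁ N) (a₂ : Seq β₂ N), β₁ < α → β₂ < α →
    s.nf M₀ M₂ a₁ → (∀ i, a₂ i ∈ M₂) → tpIn hM₀ a₂ ∈ s.bs M₀ β₂ →
    ∃ (N' : Type u) (_ : L.Structure N') (h : N ↪[L] N') (M₁ : L.Substructure N'),
      K.MemCard κ N' ∧ K.IsEmb h ∧ (∀ i, h (a₁ i) ∈ M₁) ∧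
      s.nf (M₀.map h.toHom) M₁ (fun i => h (a₂ i))

/-- Local character. The chain is `⟨C i : i ≤ δ⟩` with last member `C δ = M`. -/
def LocalCharacter (κ : Cardinal.{u}) : Prop :=
  ∀ (δ : Ordinal.{u}), Order.IsSuccLimit δ → ∀ (M : Type u) [L.Structure M]
    (C : Ordinal.{u} → L.Substructure M), K.IncrCont κ δ C → C δ = ⊤ →
    ∀ (β : Ordinal.{u}), β < δ.cof.ord → ∀ p ∈ s.bs M β, ∃ i < δ, s.DNF (C i) p

/-- Continuity. The chain is `⟨C i : i ≤ δ⟩` with last member `C δ = M`, and `p i` is a basic type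
of length `l i` over `C i`. The second half says that any `q` with restrictions `p i`
does not fork over `C 0` if none of the `p i` does. -/
def Continuity (α : Ordinal.{u}) (κ : Cardinal.{u}) : Prop :=
  ∀ (δ : Ordinal.{u}), Order.IsSuccLimit δ → ∀ (M : Type u) [L.Structure M]
    (C : Ordinal.{u} → L.Substructure M) (hC : K.IncrCont κ δ C), C δ = ⊤ →
    ∀ (l : Ordinal.{u} → Ordinal.{u}) (hl : ∀ i j, i ≤ j → j ≤ δ → l i ≤ l j),
    (∀ j ≤ δ, Order.IsSuccLimit j → IsLUB (l '' Set.Iio j) (l j)) → (∀ i ≤ δ, l i < α) →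
    ∀ p : ∀ i, K.GType (C i) (l i), (∀ i < δ, p i ∈ s.bs (C i) (l i)) →
    (∀ (j i : Ordinal.{u}) (hji : j < i) (hi : i < δ),
      (p i).restrict (Substructure.inclusion (hC.2.1 j i hji.le hi.le))
        (isEmb_inclusion _ (hC.1 j (hji.trans hi).le).1 (hC.1 i hi.le).1)
        (hl j i hji.le hi.le) = p j) →
    (∃ q ∈ s.bs M (l δ), ∀ (i : Ordinal.{u}) (hi : i < δ),
      q.restrict (C i).subtype (isEmb_subtype (hC.1 i hi.le).1) (hl i δ hi.le le_rfl) = p i) ∧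
    ((∀ (i : Ordinal.{u}) (_ : i < δ), s.DNF ((C 0).comap (C i).subtype.toHom) (p i)) →
      ∀ q : K.GType M (l δ), (∀ (i : Ordinal.{u}) (hi : i < δ),
        q.restrict (C i).subtype (isEmb_subtype (hC.1 i hi.le).1) (hl i δ hi.le le_rfl) = p i) →
      s.DNF (C 0) q)

/-- Transitivity. -/
def Transitivity (α : Ordinal.{u}) (κ : Cardinal.{u}) : Prop :=
  ∀ (M₂ : Type u) [L.Structure M₂] (M₀ M₁ : L.Substructure M₂) (hM₁ : K.Strong M₂ M₁),
    K.StrongCard κ M₂ M₀ → K.StrongCard κ M₂ M₁ → M₀ ≤ M₁ →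
    ∀ β < α, ∀ p : K.GType M₂ β, s.DNF M₁ p →
    s.DNF (M₀.comap M₁.subtype.toHom) (p.restrict M₁.subtype (isEmb_subtype hM₁) le_rfl) →
    s.DNF M₀ p

/-- `s` satisfies all the axioms of a good `(<α, κ)`-frame, except possibly stability for basic
types. -/
structure IsGoodMinusSt (α : Ordinal.{u}) (κ : Cardinal.{u}) : Prop where
  pre : s.IsPreFrame α κ
  amalgamation : K.Amalgamation κ
  joint_embedding : K.JointEmbedding κ
  no_maximal : K.NoMaximalModels κ
  density : s.Density κ
  existence : s.Existence α κ
  uniqueness : s.Uniqueness α κ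
  symmetry : s.Symmetry α κ
  local_character : s.LocalCharacter κ
  continuity : s.Continuity α κ
  transitivity : s.Transitivity α κ

/-! ### Independence -/

/-- `⟨a i : i < β⟩`, `⟨C i : i ≤ β⟩` is independent in `(M, M', N)`. -/
def IndepWitness (κ : Cardinal.{u}) {N : Type u} [L.Structure N] (M M' : L.Substructure N)
    {β : Ordinal.{u}} (a : Seq β N) (C : Ordinal.{u} → L.Substructure N) : Prop :=
  K.IncrCont κ β C ∧ K.StrongCard κ N M ∧ K.StrongCard κ N M' ∧ M ≤ M' ∧ M' ≤ C 0 ∧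
  ∀ i : Set.Iio β, ∃ h : a i ∈ C (Order.succ i.1),
    s.nf (M.comap (C (Order.succ i.1)).subtype.toHom)
      ((C i.1).comap (C (Order.succ i.1)).subtype.toHom)
      (single (⟨a i, h⟩ : C (Order.succ i.1)))

/-- The sequence `a` is independent in `(M, M', N)`, that is, independent from `M'` over `M` in
`N`: this is witnessed in some extension `N⁺` of `N`. -/
def Indep (κ : Cardinal.{u}) {N : Type u} [L.Structure N] (M M' : L.Substructure N)
    {β : Ordinal.{u}} (a : Seq β N) : Prop :=
  K.StrongCard κ N M ∧ K.StrongCard κ N M' ∧ M ≤ M' ∧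
  ∃ (N' : Type u) (_ : L.Structure N') (g : N ↪[L] N') (C : Ordinal.{u} → L.Substructure N'),
    K.IsEmb g ∧ s.IndepWitness κ (M.map g.toHom) (M'.map g.toHom) (fun i => g (a i)) C

/-- The set `I` is independent from `M'` over `M` in `N`: some enumeration of it is. -/
def IndepSet (κ : Cardinal.{u}) {N : Type u} [L.Structure N] (M M' : L.Substructure N)
    (I : Set N) : Prop :=
  ∃ (β : Ordinal.{u}) (a : Seq β N), Set.range a = I ∧ s.Indep κ M M' a

/-- The elongation `s^{<α}` of a `κ`-frame `s` by independent sequences. -/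
def elongation (κ : Cardinal.{u}) (α : Ordinal.{u}) : FrameData K where
  nf M₀ M₁ β a := β < α ∧ s.Indep κ M₀ M₁ a
  bs M _ β := {p | β < α ∧ ∃ (N : Type u) (_ : L.Structure N) (e : M ↪[L] N) (he : K.IsEmb e)
    (a : Seq β N), p = tp e he a ∧ s.Indep κ e.toHom.range e.toHom.range a}

end FrameData

/-!
Everything rests on an exchange principle: if `⟨a i : i < κ⟩` is independent from `M₀` over `M` with
`κ` regular infinite, and `X ⊆ N` has fewer than `κ` elements, then some `a i` is free over `M` from
a model `B` that contains `M₀` and `X` (`FrameData.IsGoodMinusSt.exists_nf_of_mk_lt`). If `X` is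
itself an independent set, then amalgamating over `B` a nonforking copy of `a i` with a chain
witnessing the independence of `X` shows that `X ∪ {a i}` is independent (`indep_snoc`). Hence a
maximal independent set `J` cannot be smaller than an infinite independent set `I`
(`mk_le_of_maximal`): take `X = J` and a regular `κ` with `|J| < κ ≤ |I|`, namely `ℵ₀` or `|J|⁺`.
No enumeration of `I` has to be rearranged, since an initial segment of any enumeration serves.

The exchange principle holds because a chain `⟨C j : j ≤ κ⟩` witnessing the independence of
`⟨a i : i < κ⟩` in a model `N` can be enlarged, together with `N`, to a witnessing chain whose last
member is the whole ambient model (`IndepChain.exists_ge_eq`). By regularity `X` is then contained in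
some `C i` with `i < κ`, and `a i` is free from `C i`. For the enlargement, note that as long as
`C κ ≠ N` density gives an element `c` of `N` of basic type over `C κ`, which by local character is
free from `C κ` over some `C n` with `n < κ`. The chain is extended above level `n` so as to catch
`c` (`IndepChain.exists_ge_mem`): models `D j ⊇ C j` are built by recursion on `j`, each step being
an amalgamation of `D j` and `C (j + 1)` over `C j` in which `a j` is free from `D j` and `c` is free
from `C (j + 1)` (`exists_symmetric_amalgam`, which uses symmetry for single elements), and at the
end uniqueness of nonforking extensions identifies the new copy of `c` with the old one. Continuity
allows unions of chains of at most `λ` such enlargements, and the general principle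
`exists_ge_closed` then yields an enlargement in which nothing more can be caught.

To have unions instead of direct limits, the models in these transfinite constructions are placed on
subsets of a fixed set `Ω` of cardinality greater than `λ` (`CMod`).
-/

/-! ### Embeddings and Galois types in an abstract elementary class -/

namespace AEC

variable {L : FirstOrder.Language.{u, u}} {K : AEC L} {lam : Cardinal.{u}}

theorem IsEmb.mem_right {M N : Type u} [L.Structure M] [L.Structure N] {f : M ↪[L] N}
    (hf : K.IsEmb f) : K.Mem N := (K.mem_of_strong hf).2

theorem IsEmb.mem_left {M N : Type u} [L.Structure M] [L.Structure N] {f : M ↪[L] N}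
    (hf : K.IsEmb f) : K.Mem M := K.mem_of_equiv f.equivRange.symm (K.mem_of_strong hf).1

theorem isEmb_equiv {M N : Type u} [L.Structure M] [L.Structure N] (f : M ≃[L] N)
    (hM : K.Mem M) : K.IsEmb f.toEmbedding := by
  have : f.toEmbedding.toHom.range = ⊤ := by
    rw [Equiv.toEmbedding_toHom, Equiv.toHom_range]
  unfold IsEmb
  rw [this]
  exact K.strong_top (K.mem_of_equiv f hM)

theorem isEmb_refl {M : Type u} [L.Structure M] (hM : K.Mem M) :
    K.IsEmb (Embedding.refl L M) := isEmb_equiv (FirstOrder.Language.Equiv.refl L M) hM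

theorem Strong.map {N N' : Type u} [L.Structure N] [L.Structure N'] {g : N ↪[L] N'}
    (hg : K.IsEmb g) {S : L.Substructure N} (hS : K.Strong N S) :
    K.Strong N' (S.map g.toHom) := by
  have h := isEmb_comp hg (isEmb_subtype hS)
  have e : (g.comp S.subtype).toHom.range = S.map g.toHom := by
    ext x
    simp [Hom.mem_range, Substructure.mem_map]
  unfold IsEmb at h
  rwa [e] at h

theorem Strong.of_le {N : Type u} [L.Structure N] {S T : L.Substructure N}
    (hS : K.Strong N S) (hT : K.Strong N T) (h : S ≤ T) :
    K.Strong T (S.comap T.subtype.toHom) := by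
  refine K.coherence hT ?_
  convert hS using 1
  ext x
  simp only [Substructure.mem_map, Substructure.mem_comap]
  constructor
  · rintro ⟨y, hy, rfl⟩
    exact hy
  · intro hx
    exact ⟨⟨x, h hx⟩, hx, rfl⟩

theorem strong_of_map {N N' : Type u} [L.Structure N] [L.Structure N'] {g : N ↪[L] N'}
    (hg : K.IsEmb g) {S : L.Substructure N} (hS : K.Strong N' (S.map g.toHom)) :
    K.Strong N S := by
  have h1 := Strong.of_le hS hg Hom.map_le_range
  have h2 := K.strong_of_equiv g.equivRange.symm h1
  convert h2 using 1
  ext x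
  simp only [Substructure.mem_map, Substructure.mem_comap]
  constructor
  · intro hx
    exact ⟨g.equivRange x, ⟨x, hx, by simp⟩, by simp⟩
  · rintro ⟨y, ⟨z, hz, hzy⟩, rfl⟩
    have : y = g.equivRange z := Subtype.ext (by simpa using hzy.symm)
    subst this
    simpa using hz

theorem isEmb_of_comp {M N P : Type u} [L.Structure M] [L.Structure N] [L.Structure P]
    {g : N ↪[L] P} {f : M ↪[L] N} (hg : K.IsEmb g) (h : K.IsEmb (g.comp f)) : K.IsEmb f := by
  refine strong_of_map hg ?_
  rw [← Hom.range_comp]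
  exact h

theorem mk_map {N N' : Type u} [L.Structure N] [L.Structure N'] (g : N ↪[L] N')
    (S : L.Substructure N) : #(S.map g.toHom) = #S :=
  (Cardinal.mk_congr (g.substructureEquivMap S).toEquiv).symm

theorem mk_range {N N' : Type u} [L.Structure N] [L.Structure N'] (g : N ↪[L] N') :
    #g.toHom.range = #N :=
  (Cardinal.mk_congr g.equivRange.toEquiv).symm

theorem StrongCard.map {N N' : Type u} [L.Structure N] [L.Structure N'] {g : N ↪[L] N'}
    (hg : K.IsEmb g) (hN' : #N' = lam) {S : L.Substructure N} (hS : K.StrongCard lam N S) :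
    K.StrongCard lam N' (S.map g.toHom) :=
  ⟨Strong.map hg hS.1, (mk_map g S).trans hS.2.1, hN'⟩

theorem strongCard_range {N N' : Type u} [L.Structure N] [L.Structure N'] {g : N ↪[L] N'}
    (hg : K.IsEmb g) (hN : #N = lam) (hN' : #N' = lam) : K.StrongCard lam N' g.toHom.range :=
  ⟨hg, (mk_range g).trans hN, hN'⟩

theorem aleph0_le_of_LS (h : K.LS ≤ lam) : ℵ₀ ≤ lam := (csInf_mem K.exists_ls).1.trans h

/-- The Löwenheim–Skolem–Tarski axiom at the level of `K_λ`. -/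
theorem exists_strong_of_subset (h : K.LS ≤ lam) {N : Type u} [L.Structure N] (hN : K.Mem N)
    (A : Set N) (hA : #A = lam) : ∃ S : L.Substructure N, K.Strong N S ∧ A ⊆ S ∧ #S = lam := by
  obtain ⟨S, hS, hAS, hc⟩ := (csInf_mem K.exists_ls).2.2 N hN A
  refine ⟨S, hS, hAS, le_antisymm (hc.trans ?_) ?_⟩
  · rw [hA]
    exact Cardinal.add_le_of_le (aleph0_le_of_LS h) le_rfl h
  · rw [← hA]
    exact Cardinal.mk_le_mk_of_subset hAS

theorem codRestrict_isEmb {M N : Type u} [L.Structure M] [L.Structure N] {f : M ↪[L] N}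
    (hf : K.IsEmb f) {S : L.Substructure N} (hS : K.Strong N S) (h : ∀ c, f c ∈ S) :
    K.IsEmb (f.codRestrict S h) := by
  refine isEmb_of_comp (isEmb_subtype hS) ?_
  rwa [Embedding.subtype_comp_codRestrict]

/-- The two embedded pairs `(N₁, a₁)` and `(N₂, a₂)` over `M` have a common extension in `K_λ`. -/
def Joinable (K : AEC L) (lam : Cardinal.{u}) {M N₁ N₂ : Type u} [L.Structure M] [L.Structure N₁]
    [L.Structure N₂] (e₁ : M ↪[L] N₁) (e₂ : M ↪[L] N₂) (a₁ : N₁) (a₂ : N₂) : Prop :=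
  ∃ (Q : Type u) (_ : L.Structure Q) (f₁ : N₁ ↪[L] Q) (f₂ : N₂ ↪[L] Q),
    K.MemCard lam Q ∧ K.IsEmb f₁ ∧ K.IsEmb f₂ ∧ (∀ m, f₁ (e₁ m) = f₂ (e₂ m)) ∧ f₁ a₁ = f₂ a₂

/-- `S` is a small piece of the triple `t`: a model in `K_λ` with the base and the realization. -/
def IsSmall (lam : Cardinal.{u}) {M : Type u} [L.Structure M] (t : K.Triple M 1)
    (S : L.Substructure t.carrier) : Prop :=
  K.Strong t.carrier S ∧ #S = lam ∧ (∀ m, t.emb m ∈ S) ∧ ∀ i, t.seq i ∈ S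

theorem mk_range_union {N : Type u} {A B : Set N} (h : ℵ₀ ≤ lam) (hA : #A = lam) (hB : #B ≤ lam) :
    #(A ∪ B : Set N) = lam :=
  le_antisymm ((Cardinal.mk_union_le A B).trans (Cardinal.add_le_of_le h hA.le hB))
    (hA ▸ Cardinal.mk_le_mk_of_subset Set.subset_union_left)

theorem exists_isSmall (h : K.LS ≤ lam) {M : Type u} [L.Structure M] (hM : #M = lam)
    (t : K.Triple M 1) : ∃ S, IsSmall lam t S := by
  have h0 := aleph0_le_of_LS h
  have hr : #(Set.range t.seq) ≤ lam := by
    refine le_trans ?_ (Cardinal.one_le_aleph0.trans h0)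
    rw [Cardinal.mk_le_one_iff_set_subsingleton]
    rintro _ ⟨⟨i, hi⟩, rfl⟩ _ ⟨⟨j, hj⟩, rfl⟩
    have hi' : i = 0 := Order.lt_one_iff.1 hi
    have hj' : j = 0 := Order.lt_one_iff.1 hj
    subst hi'; subst hj'; rfl
  have hA : #(Set.range t.emb) = lam := by
    rw [Cardinal.mk_range_eq _ t.emb.injective, hM]
  obtain ⟨S, hS, hAS, hc⟩ := exists_strong_of_subset h t.isEmb.mem_right _
    (mk_range_union h0 hA hr)
  exact ⟨S, hS, hc, fun m => hAS (Or.inl ⟨m, rfl⟩), fun i => hAS (Or.inr ⟨i, rfl⟩)⟩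

theorem joinable_of_small (h : K.LS ≤ lam) {N₁ N₂ N : Type u}
    [L.Structure N₁] [L.Structure N₂] [L.Structure N] {S₁ : L.Substructure N₁}
    {S₂ : L.Substructure N₂} (f₁ : N₁ ↪[L] N) (f₂ : N₂ ↪[L] N) (hf₁ : K.IsEmb f₁) (hf₂ : K.IsEmb f₂)
    (h₁ : K.Strong N₁ S₁) (h₂ : K.Strong N₂ S₂) (c₁ : #S₁ = lam) (c₂ : #S₂ = lam) :
    ∃ (Q : Type u) (_ : L.Structure Q) (g₁ : S₁ ↪[L] Q) (g₂ : S₂ ↪[L] Q),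
      K.MemCard lam Q ∧ K.IsEmb g₁ ∧ K.IsEmb g₂ ∧
      ∀ (x : S₁) (y : S₂), f₁ x = f₂ y → g₁ x = g₂ y := by
  have h0 := aleph0_le_of_LS h
  have hA : #(Set.range (fun x : S₁ => f₁ x)) = lam := by
    rw [Cardinal.mk_range_eq (fun x : S₁ => f₁ x)
      (f₁.injective.comp Subtype.val_injective), c₁]
  have hB : #(Set.range (fun x : S₂ => f₂ x)) ≤ lam := by
    rw [Cardinal.mk_range_eq (fun x : S₂ => f₂ x)
      (f₂.injective.comp Subtype.val_injective), c₂]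
  obtain ⟨S, hS, hAS, hc⟩ := exists_strong_of_subset h hf₁.mem_right _
    (mk_range_union h0 hA hB)
  have m₁ : ∀ x : S₁, (f₁.comp S₁.subtype) x ∈ S := fun x => hAS (Or.inl ⟨x, rfl⟩)
  have m₂ : ∀ x : S₂, (f₂.comp S₂.subtype) x ∈ S := fun x => hAS (Or.inr ⟨x, rfl⟩)
  refine ⟨S, inferInstance, (f₁.comp S₁.subtype).codRestrict S m₁,
    (f₂.comp S₂.subtype).codRestrict S m₂, ⟨(K.mem_of_strong hS).1, hc⟩,
    codRestrict_isEmb (isEmb_comp hf₁ (isEmb_subtype h₁)) hS _,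
    codRestrict_isEmb (isEmb_comp hf₂ (isEmb_subtype h₂)) hS _, ?_⟩
  intro x y hxy
  exact Subtype.ext hxy

/-- The entry of a sequence of length one. -/
abbrev Seq.entry {N : Type u} (a : Seq 1 N) : N := a ⟨0, Set.mem_Iio.2 zero_lt_one⟩

/-- All small pieces of the two triples are joinable. -/
def SmallEquiv (lam : Cardinal.{u}) {M : Type u} [L.Structure M] (t t' : K.Triple M 1) : Prop :=
  ∀ S S', ∀ (hS : IsSmall lam t S) (hS' : IsSmall lam t' S'),
    K.Joinable lam (t.emb.codRestrict S hS.2.2.1) (t'.emb.codRestrict S' hS'.2.2.1)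
      ⟨t.seq.entry, hS.2.2.2 _⟩ ⟨t'.seq.entry, hS'.2.2.2 _⟩

theorem smallEquiv_of_atomicEquiv (h : K.LS ≤ lam) {M : Type u} [L.Structure M]
    {t t' : K.Triple M 1} (H : K.AtomicEquiv t t') : SmallEquiv lam t t' := by
  intro S S' hS hS'
  obtain ⟨N, _, f, f', hf, hf', h1, h2⟩ := H
  obtain ⟨Q, _, g, g', hQ, hg, hg', hh⟩ :=
    joinable_of_small h f f' hf hf' hS.1 hS'.1 hS.2.1 hS'.2.1
  exact ⟨Q, _, g, g', hQ, hg, hg', fun m => hh _ _ (h1 m), hh _ _ (h2 _)⟩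

theorem Joinable.symm {M N₁ N₂ : Type u} [L.Structure M] [L.Structure N₁]
    [L.Structure N₂] {e₁ : M ↪[L] N₁} {e₂ : M ↪[L] N₂} {a₁ : N₁} {a₂ : N₂}
    (H : K.Joinable lam e₁ e₂ a₁ a₂) : K.Joinable lam e₂ e₁ a₂ a₁ := by
  obtain ⟨Q, i, f, f', hQ, hf, hf', h1, h2⟩ := H
  exact ⟨Q, i, f', f, hQ, hf', hf, fun m => (h1 m).symm, h2.symm⟩

theorem Joinable.trans (ha : K.Amalgamation lam) {M N₁ N₂ N₃ : Type u} [L.Structure M]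
    [L.Structure N₁] [L.Structure N₂] [L.Structure N₃] {e₁ : M ↪[L] N₁} {e₂ : M ↪[L] N₂}
    {e₃ : M ↪[L] N₃} {a₁ : N₁} {a₂ : N₂} {a₃ : N₃} (c : #N₂ = lam)
    (H : K.Joinable lam e₁ e₂ a₁ a₂) (H' : K.Joinable lam e₂ e₃ a₂ a₃) :
    K.Joinable lam e₁ e₃ a₁ a₃ := by
  obtain ⟨Q, i, f, f', hQ, hf, hf', h1, h2⟩ := H
  obtain ⟨Q', i', g, g', hQ', hg, hg', h1', h2'⟩ := H'
  obtain ⟨R, _, k, k', hR, hk, hk', hh⟩ :=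
    ha N₂ Q Q' f' g ⟨hf'.mem_left, c⟩ hQ hQ' hf' hg
  refine ⟨R, _, k.comp f, k'.comp g', hR, isEmb_comp hk hf, isEmb_comp hk' hg', fun m => ?_, ?_⟩
  · simp only [Embedding.comp_apply]
    rw [h1, hh, h1']
  · simp only [Embedding.comp_apply]
    rw [h2, hh, h2']

theorem smallEquiv_of_eqvGen (h : K.LS ≤ lam) (ha : K.Amalgamation lam) {M : Type u}
    [L.Structure M] (hM : #M = lam) {t t' : K.Triple M 1}
    (H : Relation.EqvGen K.AtomicEquiv t t') : SmallEquiv lam t t' := by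
  induction H with
  | rel t t' h' => exact smallEquiv_of_atomicEquiv h h'
  | refl t =>
    exact smallEquiv_of_atomicEquiv h ⟨t.carrier, _, Embedding.refl L _, Embedding.refl L _,
      isEmb_refl t.isEmb.mem_right, isEmb_refl t.isEmb.mem_right, fun _ => rfl, fun _ => rfl⟩
  | symm t t' _ ih => exact fun S S' hS hS' => (ih S' S hS' hS).symm
  | trans t t' t'' _ _ ih ih' =>
    intro S S'' hS hS''
    obtain ⟨S', hS'⟩ := exists_isSmall h hM t'
    exact (ih S S' hS hS').trans ha hS'.2.1 (ih' S' S'' hS' hS'')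

/-- Over `K_λ` with amalgamation, equality of Galois types realized in models of size `λ` amounts
to the existence of a common extension of size `λ`. -/
theorem joinable_of_tp_eq (h : K.LS ≤ lam) (ha : K.Amalgamation lam) {M N₁ N₂ : Type u}
    [L.Structure M] [L.Structure N₁] [L.Structure N₂] (hM : #M = lam) (hN₁ : #N₁ = lam)
    (hN₂ : #N₂ = lam) {e₁ : M ↪[L] N₁} {e₂ : M ↪[L] N₂} (he₁ : K.IsEmb e₁) (he₂ : K.IsEmb e₂)
    {a₁ : Seq 1 N₁} {a₂ : Seq 1 N₂} (H : tp e₁ he₁ a₁ = tp e₂ he₂ a₂) :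
    K.Joinable lam e₁ e₂ a₁.entry a₂.entry := by
  have H' := smallEquiv_of_eqvGen h ha hM (Quot.eqvGen_exact H)
  have key : ∀ (N : Type u) [L.Structure N] (e : M ↪[L] N) (he : K.IsEmb e) (a : Seq 1 N),
      #N = lam → IsSmall lam (⟨N, e, he, a⟩ : K.Triple M 1) ⊤ := fun N _ e he a hN =>
    ⟨K.strong_top he.mem_right, by rw [← hN]; exact Cardinal.mk_univ,
      fun m => Substructure.mem_top _, fun i => Substructure.mem_top _⟩
  obtain ⟨Q, i, f, f', hQ, hf, hf', h1, h2⟩ :=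
    H' ⊤ ⊤ (key N₁ e₁ he₁ a₁ hN₁) (key N₂ e₂ he₂ a₂ hN₂)
  refine ⟨Q, i, f.comp (Substructure.topEquiv.symm.toEmbedding),
    f'.comp (Substructure.topEquiv.symm.toEmbedding), hQ,
    isEmb_comp hf (isEmb_equiv _ he₁.mem_right), isEmb_comp hf' (isEmb_equiv _ he₂.mem_right),
    h1, h2⟩

theorem tp_eq_of_joinable {M N₁ N₂ : Type u}
    [L.Structure M] [L.Structure N₁] [L.Structure N₂]
    {e₁ : M ↪[L] N₁} {e₂ : M ↪[L] N₂} (he₁ : K.IsEmb e₁) (he₂ : K.IsEmb e₂)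
    {a₁ : N₁} {a₂ : N₂} (H : K.Joinable lam e₁ e₂ a₁ a₂) :
    tp e₁ he₁ (single a₁) = tp e₂ he₂ (single a₂) := by
  obtain ⟨Q, i, f, f', hQ, hf, hf', h1, h2⟩ := H
  exact Quot.sound ⟨Q, i, f, f', hf, hf', h1, fun _ => h2⟩

theorem seq_one_eq {N : Type u} (a : Seq 1 N) : a = single a.entry := by
  funext ⟨i, hi⟩
  have hi' : i = 0 := Order.lt_one_iff.1 hi
  subst hi'
  rfl

theorem notMem_range_of_nonalg {M N : Type u} [L.Structure M] [L.Structure N] {e : M ↪[L] N}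
    (he : K.IsEmb e) {β : Ordinal.{u}} {a : Seq β N} (h : (tp e he a).Nonalg) :
    ∀ i, a i ∉ e.toHom.range := by
  let P : K.GType M β → Prop := Quot.lift (fun t => ∀ i, t.seq i ∉ t.emb.toHom.range) (by
    rintro t t' ⟨N, _, f, f', hf, hf', h1, h2⟩
    refine propext (forall_congr' fun i => not_congr ?_)
    constructor
    · rintro ⟨m, hm⟩
      exact ⟨m, f'.injective ((h1 m).symm.trans ((congrArg f hm).trans (h2 i)))⟩
    · rintro ⟨m, hm⟩
      exact ⟨m, f.injective ((h1 m).trans ((congrArg f' hm).trans (h2 i).symm))⟩)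
  obtain ⟨t, ht, hn⟩ := h
  have : P (tp e he a) := by
    rw [ht]
    exact hn
  exact this

end AEC

/-! ### Calculus of freeness for single elements -/

namespace FrameData

open AEC

variable {L : FirstOrder.Language.{u, u}} {K : AEC L} {s : FrameData K} {lam : Cardinal.{u}}

theorem mk_eq_of_between {N : Type u} [L.Structure N] {S T : L.Substructure N} (h : S ≤ T)
    (hS : #S = lam) (hN : #N = lam) : #T = lam :=
  le_antisymm (hN ▸ Cardinal.mk_set_le _) (hS ▸ Cardinal.mk_le_mk_of_subset h)

theorem range_comp_eq_map {A B C : Type u} [L.Structure A] [L.Structure B] [L.Structure C]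
    (g : B ↪[L] C) (f : A ↪[L] B) : (g.comp f).toHom.range = f.toHom.range.map g.toHom :=
  Hom.range_comp f.toHom g.toHom

theorem map_comp_eq {A B C : Type u} [L.Structure A] [L.Structure B] [L.Structure C]
    (g : B ↪[L] C) (f : A ↪[L] B) (S : L.Substructure A) :
    S.map (g.comp f).toHom = (S.map f.toHom).map g.toHom :=
  (Substructure.map_map S g.toHom f.toHom).symm

theorem map_comap_subtype {N : Type u} [L.Structure N] {S T : L.Substructure N} (h : S ≤ T) :
    (S.comap T.subtype.toHom).map T.subtype.toHom = S := by
  ext x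
  simp only [Substructure.mem_map, Substructure.mem_comap]
  constructor
  · rintro ⟨y, hy, rfl⟩
    exact hy
  · intro hx
    exact ⟨⟨x, h hx⟩, hx, rfl⟩

theorem map_refl_eq {N : Type u} [L.Structure N] (S : L.Substructure N) :
    S.map (Embedding.refl L N).toHom = S := Substructure.map_id S

theorem map_congr {A B : Type u} [L.Structure A] [L.Structure B] {f g : A ↪[L] B}
    {S : L.Substructure A} (h : ∀ x ∈ S, f x = g x) : S.map f.toHom = S.map g.toHom := by
  ext y
  simp only [Substructure.mem_map]
  constructor
  · rintro ⟨x, hx, rfl⟩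
    exact ⟨x, hx, (h x hx).symm⟩
  · rintro ⟨x, hx, rfl⟩
    exact ⟨x, hx, h x hx⟩

/-- Freeness is preserved by `K`-embeddings. -/
theorem IsPreFrame.nf_map (hp : s.IsPreFrame 2 lam) {N N' : Type u} [L.Structure N]
    [L.Structure N'] {S T : L.Substructure N} {a : N} (H : s.nf S T (single a))
    {h : N ↪[L] N'} (hh : K.IsEmb h) (hN' : #N' = lam) :
    s.nf (S.map h.toHom) (T.map h.toHom) (single (h a)) := by
  have hd := hp.nf_dom _ _ _ H
  exact hp.nf_mono_ext S T S T (single a) id strictMono_id H le_rfl hd.2.2.1 le_rfl hd.1 hd.2.1 h hh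
    ⟨hh.mem_right, hN'⟩

/-- Freeness may be computed in any `K`-submodel of size `λ` of the ambient model. -/
theorem IsPreFrame.nf_of_map (hp : s.IsPreFrame 2 lam) {N N' : Type u} [L.Structure N]
    [L.Structure N'] {S T : L.Substructure N} {a : N} {h : N ↪[L] N'} (hh : K.IsEmb h)
    (hN : #N = lam) (H : s.nf (S.map h.toHom) (T.map h.toHom) (single (h a))) :
    s.nf S T (single a) := by
  have hd := hp.nf_dom _ _ _ H
  have h1 := hp.nf_mono_sub _ _ _ _ h.toHom.range (single (h a)) id strictMono_id H le_rfl
    hd.2.2.1 le_rfl Hom.map_le_range hd.1 hd.2.1 (strongCard_range hh hN hd.1.2.2)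
    (fun _ => Hom.mem_range_self h.toHom a)
  have h2 := hp.nf_invariance h.equivRange.symm _ _ _ h1
  have key : ∀ S : L.Substructure N, ((S.map h.toHom).comap h.toHom.range.subtype.toHom).map
      h.equivRange.symm.toHom = S := by
    intro S
    ext x
    simp only [Substructure.mem_map, Substructure.mem_comap]
    constructor
    · rintro ⟨y, ⟨z, hz, hzy⟩, rfl⟩
      have : y = h.equivRange z := Subtype.ext (by simpa using hzy.symm)
      subst this
      simpa using hz
    · intro hx
      exact ⟨h.equivRange x, ⟨x, hx, by simp⟩, by simp⟩
  rw [key, key] at h2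
  convert h2 using 2
  exact (h.equivRange.symm_apply_apply a).symm

/-- Monotonicity in the base and in the right side. -/
theorem IsPreFrame.nf_mono (hp : s.IsPreFrame 2 lam) {N : Type u} [L.Structure N]
    {S T S' T' : L.Substructure N} {a : N} (H : s.nf S T (single a)) (h1 : S ≤ S') (h2 : S' ≤ T')
    (h3 : T' ≤ T) (hS : K.Strong N S') (hT : K.Strong N T') : s.nf S' T' (single a) := by
  have hd := hp.nf_dom _ _ _ H
  have c1 := mk_eq_of_between h1 hd.1.2.1 hd.1.2.2
  have c2 := mk_eq_of_between h2 c1 hd.1.2.2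
  have := hp.nf_mono_ext S T S' T' (single a) id strictMono_id H h1 h2 h3 ⟨hS, c1, hd.1.2.2⟩
    ⟨hT, c2, hd.1.2.2⟩ (Embedding.refl L N) (isEmb_refl (K.mem_of_strong hS).2)
    ⟨(K.mem_of_strong hS).2, hd.1.2.2⟩
  rwa [map_refl_eq, map_refl_eq] at this

theorem IsPreFrame.bs_tpIn (hp : s.IsPreFrame 2 lam) {N : Type u} [L.Structure N]
    {S T : L.Substructure N} {a : N} (H : s.nf S T (single a)) (hT : K.Strong N T) :
    tpIn hT (single a) ∈ s.bs T 1 :=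
  hp.bs_of_nf T hT _ (hp.nf_mono H (hp.nf_dom _ _ _ H).2.2.1 le_rfl le_rfl hT hT)

theorem IsPreFrame.notMem_of_nf (hp : s.IsPreFrame 2 lam) {N : Type u} [L.Structure N]
    {S T : L.Substructure N} {a : N} (H : s.nf S T (single a)) : a ∉ T := by
  have hT := (hp.nf_dom _ _ _ H).2.1.1
  have h1 := (hp.bs_dom _ _ _ (hp.bs_tpIn H hT)).2.2
  have h2 := notMem_range_of_nonalg (isEmb_subtype hT) h1 ⟨0, Set.mem_Iio.2 zero_lt_one⟩
  rwa [Substructure.range_subtype] at h2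

/-- Nonforking of a type can be checked on any of its realizations in a model of size `λ`. -/
theorem IsGoodMinusSt.dnf_iff (hs : s.IsGoodMinusSt 2 lam) {M N : Type u} [L.Structure M]
    [L.Structure N] {M₀ : L.Substructure M} {e : M ↪[L] N} (he : K.IsEmb e) (hM : #M = lam)
    (hN : #N = lam) {a : N} :
    s.DNF M₀ (tp e he (single a)) ↔ s.nf (M₀.map e.toHom) e.toHom.range (single a) := by
  constructor
  · rintro ⟨N', _, e', he', a', h1, h2⟩
    have hd := hs.pre.nf_dom _ _ _ h2
    obtain ⟨Q, _, f, f', hQ, hf, hf', hm, ha⟩ :=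
      joinable_of_tp_eq hs.pre.ls_le hs.amalgamation hM hN hd.1.2.2 he he' h1
    rw [seq_one_eq a'] at h2
    have h3 := hs.pre.nf_map h2 hf' hQ.2
    refine hs.pre.nf_of_map hf hN ?_
    have hc : f.comp e = f'.comp e' := Embedding.ext hm
    rw [← map_comp_eq, ← range_comp_eq_map] at h3 ⊢
    rw [hc]
    have ha' : f a = f' a'.entry := ha
    rw [ha']
    exact h3
  · intro h
    exact ⟨N, _, e, he, _, rfl, h⟩

theorem range_subtype_comp_subtype {N : Type u} [L.Structure N] {T U : L.Substructure N}
    (h : T ≤ U) : (U.subtype.comp (T.comap U.subtype.toHom).subtype).toHom.range = T := by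
  rw [range_comp_eq_map, Substructure.range_subtype, map_comap_subtype h]

/-- Transitivity. -/
theorem IsGoodMinusSt.nf_trans (hs : s.IsGoodMinusSt 2 lam) {N : Type u} [L.Structure N]
    {S T U : L.Substructure N} {a : N} (h1 : s.nf S T (single a)) (h2 : s.nf T U (single a)) :
    s.nf S U (single a) := by
  have d1 := hs.pre.nf_dom _ _ _ h1
  have d2 := hs.pre.nf_dom _ _ _ h2
  have hST := d1.2.2.1
  have hTU := d2.2.2.1
  have hU := d2.2.1
  have cU : ∀ {V : L.Substructure N}, V ≤ U → #(V.comap U.subtype.toHom) = #V := by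
    intro V hV
    conv_rhs => rw [← map_comap_subtype hV]
    rw [mk_map]
  have hM₁ : K.Strong U (T.comap U.subtype.toHom) := Strong.of_le d1.2.1.1 hU.1 hTU
  have hd1 : s.DNF (T.comap U.subtype.toHom) (tpIn hU.1 (single a)) := by
    unfold tpIn
    rw [hs.dnf_iff _ hU.2.1 hU.2.2, map_comap_subtype hTU, Substructure.range_subtype]
    exact h2
  have hd2 : s.DNF ((S.comap U.subtype.toHom).comap (T.comap U.subtype.toHom).subtype.toHom)
      ((tpIn hU.1 (single a)).restrict (T.comap U.subtype.toHom).subtype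
        (isEmb_subtype hM₁) le_rfl) := by
    change s.DNF _ (tp (U.subtype.comp (T.comap U.subtype.toHom).subtype) _ (single a))
    rw [hs.dnf_iff _ ((cU hTU).trans d1.2.1.2.1) hU.2.2, range_subtype_comp_subtype hTU,
      map_comp_eq, map_comap_subtype (Substructure.monotone_comap hST),
      map_comap_subtype (hST.trans hTU)]
    exact h1
  have h := hs.transitivity U (S.comap U.subtype.toHom) (T.comap U.subtype.toHom) hM₁
    ⟨Strong.of_le d1.1.1 hU.1 (hST.trans hTU), (cU (hST.trans hTU)).trans d1.1.2.1, hU.2.1⟩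
    ⟨hM₁, (cU hTU).trans d1.2.1.2.1, hU.2.1⟩ (Substructure.monotone_comap hST) 1
    one_lt_two _ hd1 hd2
  unfold tpIn at h
  rwa [hs.dnf_iff _ hU.2.1 hU.2.2, map_comap_subtype (hST.trans hTU),
    Substructure.range_subtype] at h

/-- Extension: an element free from `B` can be moved over `B` so as to be free from any extension
`R` of `B`. -/
theorem IsGoodMinusSt.nf_extend (hs : s.IsGoodMinusSt 2 lam) {N R : Type u} [L.Structure N]
    [L.Structure R] {S B : L.Substructure N} {a : N} (h : s.nf S B (single a))
    {k : B ↪[L] R} (hk : K.IsEmb k) (hR : #R = lam) :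
    ∃ (Q : Type u) (_ : L.Structure Q) (f : N ↪[L] Q) (g : R ↪[L] Q), K.MemCard lam Q ∧
      K.IsEmb f ∧ K.IsEmb g ∧ (∀ b : B, f b = g (k b)) ∧
      s.nf (S.map f.toHom) g.toHom.range (single (f a)) := by
  have d := hs.pre.nf_dom _ _ _ h
  have hB := d.2.1
  obtain ⟨q, -, ⟨N', _, e', he', a', rfl, hnf⟩, hq⟩ := hs.existence B R k hk
    ⟨(K.mem_of_strong hB.1).1, hB.2.1⟩ ⟨hk.mem_right, hR⟩ 1 1 le_rfl one_lt_two _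
    (hs.pre.bs_tpIn h hB.1)
  have d' := hs.pre.nf_dom _ _ _ hnf
  obtain ⟨Q, _, f₁, f, hQ, hf₁, hf, hm, ha⟩ := joinable_of_tp_eq hs.pre.ls_le hs.amalgamation
    hB.2.1 d'.1.2.2 hB.2.2 (isEmb_comp he' hk) (isEmb_subtype hB.1) hq
  refine ⟨Q, _, f, f₁.comp e', hQ, hf, isEmb_comp hf₁ he', fun b => (hm b).symm, ?_⟩
  have h1 := hs.pre.nf_map h hf hQ.2
  rw [seq_one_eq a'] at hnf
  have h2 := hs.pre.nf_map hnf hf₁ hQ.2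
  rw [← range_comp_eq_map, ← range_comp_eq_map, ← range_comp_eq_map] at h2
  have hc : (f₁.comp (e'.comp k)) = f.comp B.subtype := Embedding.ext hm
  have ha' : f₁ a'.entry = f a := ha
  rw [hc, range_comp_eq_map f, Substructure.range_subtype, ha'] at h2
  exact hs.nf_trans h1 h2

/-- Uniqueness of nonforking extensions, for realizations. -/
theorem IsGoodMinusSt.joinable_of_nf (hs : s.IsGoodMinusSt 2 lam) {B N₁ N₂ : Type u}
    [L.Structure B] [L.Structure N₁] [L.Structure N₂] {e₁ : B ↪[L] N₁} {e₂ : B ↪[L] N₂}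
    (he₁ : K.IsEmb e₁) (he₂ : K.IsEmb e₂) {A : L.Substructure B} {a₁ : N₁} {a₂ : N₂}
    (h₁ : s.nf (A.map e₁.toHom) e₁.toHom.range (single a₁))
    (h₂ : s.nf (A.map e₂.toHom) e₂.toHom.range (single a₂))
    (H : K.Joinable lam (e₁.comp A.subtype) (e₂.comp A.subtype) a₁ a₂) :
    K.Joinable lam e₁ e₂ a₁ a₂ := by
  have d₁ := hs.pre.nf_dom _ _ _ h₁
  have d₂ := hs.pre.nf_dom _ _ _ h₂
  have hA : K.Strong B A := strong_of_map he₁ d₁.1.1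
  have cA : #A = lam := (mk_map e₁ A).symm.trans d₁.1.2.1
  have cB : #B = lam := (mk_range e₁).symm.trans d₁.2.1.2.1
  have := hs.uniqueness B A hA ⟨hA, cA, cB⟩ 1 one_lt_two (tp e₁ he₁ (single a₁))
    (tp e₂ he₂ (single a₂)) ((hs.dnf_iff he₁ cB d₁.1.2.2).2 h₁)
    ((hs.dnf_iff he₂ cB d₂.1.2.2).2 h₂)
    (tp_eq_of_joinable (isEmb_comp he₁ (isEmb_subtype hA)) (isEmb_comp he₂ (isEmb_subtype hA)) H)
  exact joinable_of_tp_eq hs.pre.ls_le hs.amalgamation cB d₁.1.2.2 d₂.1.2.2 he₁ he₂ this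

/-- Symmetric amalgamation: given `a` in one extension of `A` and `c` in another, both of basic
type over `A`, there is an amalgam in which each is free from the extension containing the other. -/
theorem IsGoodMinusSt.exists_symmetric_amalgam (hs : s.IsGoodMinusSt 2 lam) {A B D : Type u}
    [L.Structure A] [L.Structure B] [L.Structure D] {e₁ : A ↪[L] B} {e₂ : A ↪[L] D}
    (he₁ : K.IsEmb e₁) (he₂ : K.IsEmb e₂) {a : B} {c : D}
    (ha : s.nf e₁.toHom.range e₁.toHom.range (single a))
    (hc : s.nf e₂.toHom.range e₂.toHom.range (single c)) :
    ∃ (Q : Type u) (_ : L.Structure Q) (f : B ↪[L] Q) (g : D ↪[L] Q), K.MemCard lam Q ∧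
      K.IsEmb f ∧ K.IsEmb g ∧ (∀ x, f (e₁ x) = g (e₂ x)) ∧
      s.nf (f.comp e₁).toHom.range g.toHom.range (single (f a)) ∧
      s.nf (f.comp e₁).toHom.range f.toHom.range (single (g c)) := by
  have da := hs.pre.nf_dom _ _ _ ha
  have dc := hs.pre.nf_dom _ _ _ hc
  -- `c` is moved so as to be free from `B` over `A`
  obtain ⟨Q₁, _, f₁, g₁, hQ₁, hf₁, hg₁, hm₁, hnf₁⟩ := hs.nf_extend hc
    (k := e₁.comp e₂.equivRange.symm.toEmbedding)
    (isEmb_comp he₁ (isEmb_equiv _ (K.mem_of_strong he₂).1)) da.1.2.2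
  have hm₁' : ∀ x, f₁ (e₂ x) = g₁ (e₁ x) := by
    intro x
    have := hm₁ (e₂.equivRange x)
    simpa using this
  have hr : e₂.toHom.range.map f₁.toHom = e₁.toHom.range.map g₁.toHom := by
    rw [← range_comp_eq_map, ← range_comp_eq_map]
    congr 2
    exact Embedding.ext hm₁'
  rw [hr] at hnf₁
  have ha₁ := hs.pre.nf_map ha hg₁ hQ₁.2
  -- symmetry then produces a model containing `c` from which `a` is free
  obtain ⟨Q₂, _, h, M₁, hQ₂, hh, hcM, hnf₂⟩ := hs.symmetry Q₁ _ _
    (hs.pre.nf_dom _ _ _ hnf₁).1.1 (single (f₁ c)) (single (g₁ a)) one_lt_two one_lt_two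
    hnf₁ (fun _ => Hom.mem_range_self g₁.toHom a) (hs.pre.bs_tpIn ha₁ _)
  have d₂ := hs.pre.nf_dom _ _ _ hnf₂
  obtain ⟨Q, _, f₂, g₂, hQ, hf₂, hg₂, hm₂, hnf₃⟩ := hs.nf_extend (a := h (g₁ a)) hnf₂
    (isEmb_subtype d₂.2.1.1) hQ₂.2
  have hm₂' : ∀ x ∈ M₁, f₂ x = g₂ x := fun x hx => hm₂ ⟨x, hx⟩
  have hagree : ∀ x, f₂ (h (g₁ (e₁ x))) = g₂ (h (f₁ (e₂ x))) := by
    intro x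
    rw [hm₁' x]
    exact hm₂' _ (d₂.2.2.1 ⟨g₁ (e₁ x), ⟨e₁ x, ⟨x, rfl⟩, rfl⟩, rfl⟩)
  have hF : K.IsEmb ((f₂.comp h).comp g₁) := isEmb_comp (isEmb_comp hf₂ hh) hg₁
  have hG : K.IsEmb ((g₂.comp h).comp f₁) := isEmb_comp (isEmb_comp hg₂ hh) hf₁
  refine ⟨Q, _, (f₂.comp h).comp g₁, (g₂.comp h).comp f₁, hQ, hF, hG, hagree, ?_, ?_⟩
  · have hrange : (((f₂.comp h).comp g₁).comp e₁).toHom.range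
        = ((e₁.toHom.range.map g₁.toHom).map h.toHom).map f₂.toHom := by
      rw [range_comp_eq_map, map_comp_eq, map_comp_eq]
    rw [hrange]
    refine hs.pre.nf_mono hnf₃ le_rfl ?_ ?_ (hs.pre.nf_dom _ _ _ hnf₃).1.1 hG
    · rw [← hrange]
      rintro _ ⟨x, rfl⟩
      exact ⟨e₂ x, (hagree x).symm⟩
    · rw [range_comp_eq_map, map_comp_eq]
      exact Hom.map_le_range
  · have h4 := hs.pre.nf_map hnf₁ (isEmb_comp hf₂ hh) hQ.2
    rw [← range_comp_eq_map, ← range_comp_eq_map, ← range_comp_eq_map] at h4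
    have h5 : (f₂.comp h) (f₁ c) = ((g₂.comp h).comp f₁) c :=
      hm₂' _ (hcM ⟨0, Set.mem_Iio.2 zero_lt_one⟩)
    rw [h5] at h4
    exact h4

end FrameData

/-! ### Local character and continuity along chains of submodels -/

namespace FrameData

open AEC

variable {L : FirstOrder.Language.{u, u}} {K : AEC L} {s : FrameData K} {lam : Cardinal.{u}}

theorem incrCont_comap {N : Type u} [L.Structure N] {δ : Ordinal.{u}}
    {T : Ordinal.{u} → L.Substructure N} (hT : K.IncrCont lam δ T) :
    K.IncrCont lam δ (fun i => (T i).comap (T δ).subtype.toHom) := by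
  refine ⟨fun i hi => ⟨Strong.of_le (hT.1 i hi).1 (hT.1 δ le_rfl).1 (hT.2.1 i δ hi le_rfl), ?_⟩,
    fun i j hij hj => Substructure.monotone_comap (hT.2.1 i j hij hj), fun j hj hl x => ?_⟩
  · rw [← mk_map (T δ).subtype, map_comap_subtype (hT.2.1 i δ hi le_rfl)]
    exact (hT.1 i hi).2
  · exact hT.2.2 j hj hl (x : N)

/-- Local character for elements, along a chain inside a fixed ambient model. -/
theorem IsGoodMinusSt.exists_nf_of_bs (hs : s.IsGoodMinusSt 2 lam) {N : Type u} [L.Structure N]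
    (hN : #N = lam) {δ : Ordinal.{u}} (hδ : Order.IsSuccLimit δ)
    {T : Ordinal.{u} → L.Substructure N} (hT : K.IncrCont lam δ T) {a : N}
    (ha : tpIn (hT.1 δ le_rfl).1 (single a) ∈ s.bs (T δ) 1) :
    ∃ i < δ, s.nf (T i) (T δ) (single a) := by
  have hc : (T δ).comap (T δ).subtype.toHom = ⊤ := by
    ext x
    simp
  have hcof : (1 : Ordinal.{u}) < δ.cof.ord := by
    rw [Cardinal.lt_ord, Ordinal.card_one]
    exact Ordinal.one_lt_cof_iff.2 hδ
  obtain ⟨i, hi, h⟩ := hs.local_character δ hδ (T δ) _ (incrCont_comap hT) hc 1 hcof _ ha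
  refine ⟨i, hi, ?_⟩
  unfold tpIn at h
  rwa [hs.dnf_iff _ (hT.1 δ le_rfl).2 hN, map_comap_subtype (hT.2.1 i δ hi.le le_rfl),
    Substructure.range_subtype] at h

/-- Continuity for a single element and a continuous chain. -/
theorem IsGoodMinusSt.nf_of_forall_lt (hs : s.IsGoodMinusSt 2 lam) {N : Type u} [L.Structure N]
    (hN : #N = lam) {δ : Ordinal.{u}} (hδ : Order.IsSuccLimit δ)
    {T : Ordinal.{u} → L.Substructure N} (hT : K.IncrCont lam δ T) (hst : ∀ i, K.Strong N (T i))
    {a : N} (ha : ∀ i < δ, s.nf (T 0) (T i) (single a)) : s.nf (T 0) (T δ) (single a) := by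
  -- indices above `δ` are sent to `δ`, since the axiom wants a type for every ordinal
  set C : Ordinal.{u} → L.Substructure (T δ) :=
    fun i => (T (min i δ)).comap (T δ).subtype.toHom with hC
  have hle : ∀ i, T (min i δ) ≤ T δ := fun i => hT.2.1 _ _ (min_le_right i δ) le_rfl
  have hCi : K.IncrCont lam δ C := by
    have := incrCont_comap hT
    refine ⟨fun i hi => ?_, fun i j hij hj => ?_, fun j hj hl x => ?_⟩
    · simpa only [hC, min_eq_left hi] using this.1 i hi
    · simpa only [hC, min_eq_left hj, min_eq_left (hij.trans hj)] using this.2.1 i j hij hj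
    · have h := this.2.2 j hj hl x
      simp only [hC, min_eq_left hj]
      rw [h]
      refine exists_congr fun i => and_congr_right fun hi => ?_
      rw [min_eq_left (hi.le.trans hj)]
  have hCδ : C δ = ⊤ := by
    ext x
    simp [hC]
  have hCst : ∀ i, K.Strong (T δ) (C i) := fun i =>
    Strong.of_le (hst _) (hst δ) (hle i)
  have hδ1 := (hT.1 δ le_rfl).1
  have hcard : ∀ i, #(C i) = lam := fun i => by
    have := (hCi.1 (min i δ) (min_le_right _ _)).2
    simpa only [hC, min_assoc, min_self] using this
  have h0 : min 0 δ = 0 := min_eq_left (zero_le : (0 : Ordinal.{u}) ≤ δ)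
  let e : T δ ↪[L] N := (T δ).subtype
  have hcomp : ∀ i, K.IsEmb (e.comp (C i).subtype) := fun i =>
    isEmb_comp (isEmb_subtype hδ1) (isEmb_subtype (hCst i))
  let p : ∀ i, K.GType (C i) 1 := fun i => tp (e.comp (C i).subtype) (hcomp i) (single a)
  have hrange : ∀ i, (e.comp (C i).subtype).toHom.range = T (min i δ) := fun i =>
    range_subtype_comp_subtype (hle i)
  have hC0 : (C 0).map e.toHom = T 0 := by
    have := map_comap_subtype (hle 0)
    rw [h0] at this
    simp only [hC, h0]
    exact this
  have hdnf : ∀ i, i < δ → s.DNF ((C 0).comap (C i).subtype.toHom) (p i) := by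
    intro i hi
    rw [hs.dnf_iff _ (hcard i) hN, hrange, map_comp_eq,
      map_comap_subtype (hCi.2.1 0 i (zero_le) hi.le), hC0, min_eq_left hi.le]
    exact ha i hi
  have hbs : ∀ i, i < δ → p i ∈ s.bs (C i) 1 := by
    intro i hi
    have h1 := hs.pre.nf_of_map (S := (C i).map e.toHom) (T := (C i).map e.toHom)
      (isEmb_refl (K.mem_of_strong hδ1).2) hN (by
        rw [map_refl_eq]
        have e1 : (C i).map e.toHom = T i := by
          rw [← min_eq_left hi.le]
          simp only [hC, min_assoc, min_self]
          exact map_comap_subtype (hle i)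
        rw [e1]
        exact hs.pre.nf_mono (ha i hi) (hs.pre.nf_dom _ _ _ (ha i hi)).2.2.1 le_rfl le_rfl
          (hst i) (hst i))
    have h2 := hs.pre.bs_tpIn h1 (hs.pre.nf_dom _ _ _ h1).1.1
    refine hs.pre.bs_invariance _ (isEmb_subtype (hs.pre.nf_dom _ _ _ h1).1.1)
      (e.comp (C i).subtype) (hcomp i) (e.substructureEquivMap (C i)).symm
      (FirstOrder.Language.Equiv.refl L N) ?_ _ h2
    rintro x
    obtain ⟨y, rfl⟩ := (e.substructureEquivMap (C i)).surjective x
    simp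
  have := hs.continuity δ hδ (T δ) C hCi hCδ (fun _ => 1) (fun _ _ _ _ => le_rfl)
    (fun j _ hl => by
      have : (fun _ : Ordinal.{u} => (1 : Ordinal.{u})) '' Set.Iio j = {1} :=
        Set.Nonempty.image_const ⟨0, hl.bot_lt⟩ 1
      rw [this]
      exact isLUB_singleton) (fun _ _ => one_lt_two) p hbs (fun j i hji hi => rfl)
  have h := this.2 hdnf (tp e (isEmb_subtype hδ1) (single a)) (fun i hi => rfl)
  rw [hs.dnf_iff _ (hT.1 δ le_rfl).2 hN, hC0, Substructure.range_subtype] at h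
  exact h

/-- Continuity for a single element and an arbitrary chain of models, not necessarily well-ordered:
an element free from each member is free from the union. -/
theorem IsGoodMinusSt.nf_sSup (hs : s.IsGoodMinusSt 2 lam) {N : Type u} [L.Structure N]
    {M : L.Substructure N} {c : Set (L.Substructure N)} (hne : c.Nonempty)
    (hch : IsChain (· ≤ ·) c) {a : N} (ha : ∀ S ∈ c, s.nf M S (single a)) :
    s.nf M (sSup c) (single a) := by
  obtain ⟨S₀, hS₀⟩ := hne
  have d₀ := hs.pre.nf_dom _ _ _ (ha S₀ hS₀)
  have hM : K.Strong N M := d₀.1.1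
  have hN := d₀.1.2.2
  have hle : ∀ S ∈ c, M ≤ S := fun S hS => (hs.pre.nf_dom _ _ _ (ha S hS)).2.2.1
  have hcst : ∀ S ∈ c, K.Strong N S := fun S hS => (hs.pre.nf_dom _ _ _ (ha S hS)).2.1.1
  -- `D i` is the union of `M` and of the members of `c` of rank below `i` in a fixed well-ordering
  let ρ : L.Substructure N → Ordinal.{u} := Ordinal.typein WellOrderingRel
  have hρ : Function.Injective ρ := Ordinal.typein_injective _
  let c' : Ordinal.{u} → Set (L.Substructure N) := fun i => insert M {S ∈ c | ρ S < i}
  let D : Ordinal.{u} → L.Substructure N := fun i => sSup (c' i)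
  have hch' : ∀ i, IsChain (· ≤ ·) (c' i) := fun i =>
    (hch.mono fun S hS => hS.1).insert fun S hS _ => Or.inl (hle S hS.1)
  have hne' : ∀ i, (c' i).Nonempty := fun i => ⟨M, Or.inl rfl⟩
  have hDst : ∀ i, K.Strong N (D i) := fun i => by
    refine K.chain_smooth _ (hne' i) (hch' i) ?_
    rintro S (rfl | hS)
    · exact hM
    · exact hcst S hS.1
  have hmem : ∀ i x, x ∈ D i ↔ x ∈ M ∨ ∃ S ∈ c, ρ S < i ∧ x ∈ S := by
    intro i x
    change x ∈ sSup (c' i) ↔ _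
    rw [Substructure.mem_sSup_of_directedOn (hne' i) (hch' i).directedOn]
    constructor
    · rintro ⟨S, rfl | hS, hx⟩
      · exact Or.inl hx
      · exact Or.inr ⟨S, hS.1, hS.2, hx⟩
    · rintro (hx | ⟨S, hS, hr, hx⟩)
      · exact ⟨M, Or.inl rfl, hx⟩
      · exact ⟨S, Or.inr ⟨hS, hr⟩, hx⟩
  have hMD : ∀ i, M ≤ D i := fun i x hx => (hmem i x).2 (Or.inl hx)
  have hDmono : ∀ i j, i ≤ j → D i ≤ D j := fun i j hij x hx => by
    rw [hmem] at hx ⊢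
    exact hx.imp id fun ⟨S, hS, hr, hx⟩ => ⟨S, hS, hr.trans_le hij, hx⟩
  have hD0 : D 0 = M := by
    refine le_antisymm (fun x hx => ?_) (hMD 0)
    rw [hmem] at hx
    rcases hx with hx | ⟨S, hS, hr, hx⟩
    · exact hx
    · exact absurd hr (not_lt_zero)
  have hMM : s.nf M M (single a) :=
    hs.pre.nf_mono (ha S₀ hS₀) le_rfl le_rfl (hle S₀ hS₀) hM hM
  have key : ∀ i, s.nf M (D i) (single a) := by
    intro i
    induction i using Ordinal.limitRecOn with
    | zero => rwa [hD0]
    | add_one γ ih =>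
      rw [← Order.succ_eq_add_one]
      by_cases hex : ∃ S ∈ c, ρ S = γ ∧ ∀ T ∈ c, ρ T < γ → T ≤ S
      · obtain ⟨S, hS, hr, hT⟩ := hex
        have : D (Order.succ γ) = S := by
          refine le_antisymm (fun x hx => ?_) fun x hx =>
            (hmem _ x).2 (Or.inr ⟨S, hS, hr ▸ Order.lt_succ _, hx⟩)
          rw [hmem] at hx
          rcases hx with hx | ⟨T, hTc, hr', hx⟩
          · exact hle S hS hx
          · rcases (Order.lt_succ_iff.1 hr').lt_or_eq with h | h
            · exact hT T hTc h hx
            · rwa [← hρ (h.trans hr.symm)]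
        rw [this]
        exact ha S hS
      · have : D (Order.succ γ) = D γ := by
          refine le_antisymm (fun x hx => ?_) (hDmono _ _ (Order.le_succ γ))
          rw [hmem] at hx ⊢
          rcases hx with hx | ⟨T, hTc, hr', hx⟩
          · exact Or.inl hx
          · rcases (Order.lt_succ_iff.1 hr').lt_or_eq with h | h
            · exact Or.inr ⟨T, hTc, h, hx⟩
            · push Not at hex
              obtain ⟨T', hT', hr'', hnot⟩ := hex T hTc h
              exact Or.inr ⟨T', hT', hr'', (hch.total hTc hT').resolve_right hnot hx⟩
        rw [this]
        exact ih
    | limit δ hδ ih =>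
      have hcont : K.IncrCont lam δ D := by
        refine ⟨fun i _ => ⟨hDst i, mk_eq_of_between (hMD i) d₀.1.2.1 hN⟩,
          fun i j hij _ => hDmono i j hij, fun j _ hj x => ⟨fun hx => ?_, ?_⟩⟩
        · rw [hmem] at hx
          rcases hx with hx | ⟨S, hS, hr, hx⟩
          · exact ⟨0, hj.bot_lt, hMD 0 hx⟩
          · exact ⟨Order.succ (ρ S), hj.succ_lt hr,
              (hmem _ x).2 (Or.inr ⟨S, hS, Order.lt_succ _, hx⟩)⟩
        · rintro ⟨i, hi, hx⟩
          exact hDmono i j hi.le hx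
      have := hs.nf_of_forall_lt hN hδ hcont hDst (a := a) (fun i hi => by rw [hD0]; exact ih i hi)
      rwa [hD0] at this
  have hfin : D (Ordinal.type (WellOrderingRel (α := L.Substructure N))) = sSup c := by
    ext x
    rw [hmem, Substructure.mem_sSup_of_directedOn ⟨S₀, hS₀⟩ hch.directedOn]
    constructor
    · rintro (hx | ⟨S, hS, -, hx⟩)
      · exact ⟨S₀, hS₀, hle S₀ hS₀ hx⟩
      · exact ⟨S, hS, hx⟩
    · rintro ⟨S, hS, hx⟩
      exact Or.inr ⟨S, hS, Ordinal.typein_lt_type _ S, hx⟩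
  rw [← hfin]
  exact key _

end FrameData

/-! ### Extensions in which nothing more can be caught -/

/-- Above every `t₀` there is a `t` such that `U` catches no further element of the fixed set `X`
beyond `t`. This is Zorn's lemma for the order in which `t < t'` means that `t ≤ t'` and `U t'`
catches an element of `X` that is not in `U t`; a chain without a last
element has a cofinal subset indexed by elements of `X`. -/
theorem exists_ge_forall_inter_subset {T : Type*} [Preorder T] {Ω : Type u} {lam : Cardinal.{u}}
    (U : T → Set Ω) (hU : Monotone U)
    (ub : ∀ (ι : Type u) [Nonempty ι] (f : ι → T), #ι ≤ lam → (∀ i j, f i ≤ f j ∨ f j ≤ f i) →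
      ∃ t, ∀ i, f i ≤ t) (X : Set Ω) (hX : #X ≤ lam) (t₀ : T) :
    ∃ t, t₀ ≤ t ∧ ∀ t', t ≤ t' → U t' ∩ X ⊆ U t := by
  let r : {t // t₀ ≤ t} → {t // t₀ ≤ t} → Prop := fun t t' =>
    t = t' ∨ (t ≤ t' ∧ ¬ U t' ∩ X ⊆ U t)
  have htrans : ∀ {a b c}, r a b → r b c → r a c := by
    rintro a b c (rfl | ⟨h1, h2⟩) (rfl | ⟨h3, h4⟩)
    · exact Or.inl rfl
    · exact Or.inr ⟨h3, h4⟩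
    · exact Or.inr ⟨h1, h2⟩
    · exact Or.inr ⟨h1.trans h3, fun h => h2 fun x hx => h ⟨hU h3 hx.1, hx.2⟩⟩
  have hub : ∀ c, IsChain r c → ∃ ub, ∀ a ∈ c, r a ub := by
    intro c hc
    have hc' : ∀ t ∈ c, ∀ t' ∈ c, r t t' ∨ r t' t := fun t ht t' ht' => by
      by_cases h : t = t'
      · exact Or.inl (Or.inl h)
      · exact hc ht ht' h
    by_cases htop : ∃ t ∈ c, ∀ t' ∈ c, U t'.1 ∩ X ⊆ U t.1
    · obtain ⟨t, ht, hmax⟩ := htop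
      refine ⟨t, fun t' ht' => ?_⟩
      rcases hc' t' ht' t ht with h | rfl | ⟨-, h⟩
      · exact h
      · exact Or.inl rfl
      · exact absurd (hmax t' ht') h
    push Not at htop
    rcases c.eq_empty_or_nonempty with rfl | ⟨t₁, ht₁⟩
    · exact ⟨⟨t₀, le_rfl⟩, fun _ h => absurd h (Set.notMem_empty _)⟩
    -- one member of `c` is chosen for each element of `X` that some member catches
    let ι := {x : Ω // x ∈ X ∧ ∃ t ∈ c, x ∈ U t.1}
    have hcatch : ∀ t ∈ c, ∃ x : ι, x.1 ∉ U t.1 := fun t ht => by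
      obtain ⟨t', ht', hn⟩ := htop t ht
      obtain ⟨x, hx, hxt⟩ := Set.not_subset.1 hn
      exact ⟨⟨x, hx.2, t', ht', hx.1⟩, hxt⟩
    have : Nonempty ι := ⟨(hcatch t₁ ht₁).choose⟩
    choose f hf hxf using fun x : ι => x.2.2
    have hιX : #ι ≤ lam := (Cardinal.mk_subtype_mono fun x hx => hx.1).trans hX
    obtain ⟨t, ht⟩ := ub ι (fun x => (f x).1) hιX (fun x y => by
      rcases hc' _ (hf x) _ (hf y) with (h | h) | h | h
      · exact Or.inl (congrArg Subtype.val h).le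
      · exact Or.inl h.1
      · exact Or.inr (congrArg Subtype.val h).le
      · exact Or.inr h.1)
    refine ⟨⟨t, t₁.2.trans ?_⟩, fun t' ht' => ?_⟩
    · obtain ⟨x, hx⟩ := hcatch t₁ ht₁
      refine le_trans ?_ (ht x)
      rcases hc' _ ht₁ _ (hf x) with (h | h) | h | h
      · exact (congrArg Subtype.val h).le
      · exact h.1
      · exact absurd (h ▸ hxf x) hx
      · exact absurd (hU h.1 (hxf x)) hx
    · obtain ⟨x, hx⟩ := hcatch t' ht'
      have hle : t' ≤ f x := by
        rcases hc' _ ht' _ (hf x) with (h | h) | h | h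
        · exact h.le
        · exact h.1
        · exact absurd (h ▸ hxf x) hx
        · exact absurd (hU h.1 (hxf x)) hx
      exact Or.inr ⟨le_trans hle (ht x), fun h => hx (h ⟨hU (ht x) (hxf x), x.2.1⟩)⟩
  obtain ⟨m, hm⟩ := exists_maximal_of_chains_bounded (r := r) hub htrans
  refine ⟨m, m.2, fun t' ht' => ?_⟩
  by_contra hn
  rcases hm ⟨t', m.2.trans ht'⟩ (Or.inr ⟨ht', hn⟩) with h | ⟨h, -⟩
  · exact hn (Set.inter_subset_left.trans (congrArg (fun t => U t.1) h).le)
  · exact hn (Set.inter_subset_left.trans (hU h))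

/-- Replacement for a pressing-down argument on `λ⁺`: if unions of chains indexed by sets of
cardinality `≤ λ` exist in `T`, then above each `t₀` there is a `t` none of whose elements can be
newly caught by `U` in a further extension. -/
theorem exists_ge_closed {T : Type*} [Preorder T] {Ω : Type u} {lam : Cardinal.{u}}
    (h0 : ℵ₀ ≤ lam) (N U : T → Set Ω) (hU : Monotone U) (hN : ∀ t, #(N t) ≤ lam)
    (ub : ∀ (ι : Type u) [Nonempty ι] (f : ι → T), #ι ≤ lam → (∀ i j, f i ≤ f j ∨ f j ≤ f i) →
      ∃ t, (∀ i, f i ≤ t) ∧ N t ⊆ ⋃ i, N (f i)) (t₀ : T) :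
    ∃ t, t₀ ≤ t ∧ ∀ t', t ≤ t' → U t' ∩ N t ⊆ U t := by
  choose F hF hcl using fun t => exists_ge_forall_inter_subset U hU
    (fun ι _ f h1 h2 => (ub ι f h1 h2).imp fun _ h => h.1) (N t) (hN t) t
  let g : ℕ → T := fun n => F^[n] t₀
  have hg : Monotone g := monotone_nat_of_le_succ fun n => by
    simp only [g, Function.iterate_succ_apply']
    exact hF _
  obtain ⟨t, ht, hNt⟩ := ub (ULift.{u} ℕ) (fun n => g n.down) (by simpa using h0)
    (fun i j => (le_total i.down j.down).imp (fun h => hg h) (fun h => hg h))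
  refine ⟨t, ht ⟨0⟩, fun t' ht' x hx => ?_⟩
  obtain ⟨n, hn⟩ := Set.mem_iUnion.1 (hNt hx.2)
  have h1 : F (g n.down) = g (n.down + 1) := by
    simp only [g, Function.iterate_succ_apply']
  have h2 := ht ⟨n.down + 1⟩
  refine hU h2 ?_
  change x ∈ U (g (n.down + 1))
  rw [← h1]
  refine hcl (g n.down) t' (le_trans ?_ ht') ⟨hx.1, hn⟩
  rw [h1]
  exact h2

/-! ### Models on subsets of a fixed set -/

section

open AEC

variable {L : FirstOrder.Language.{u, u}}

/-- A model in `K_λ` whose underlying set is a subset of the fixed set `Ω`. -/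
structure CMod (K : AEC L) (lam : Cardinal.{u}) (Ω : Type u) where
  carrier : Set Ω
  [str : L.Structure carrier]
  mem : K.MemCard lam carrier

namespace CMod

attribute [instance] CMod.str

variable {K : AEC L} {lam : Cardinal.{u}} {Ω : Type u}

/-- `A ≤ B` means that the inclusion of underlying sets is a `K`-embedding. -/
instance : Preorder (CMod K lam Ω) where
  le A B := ∃ e : A.carrier ↪[L] B.carrier, K.IsEmb e ∧ ∀ x, (e x : Ω) = x
  le_refl A := ⟨Embedding.refl L _, isEmb_refl A.mem.1, fun _ => rfl⟩
  le_trans A B C := fun ⟨e, he, h⟩ ⟨e', he', h'⟩ =>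
    ⟨e'.comp e, isEmb_comp he' he, fun x => (h' _).trans (h x)⟩

/-- The inclusion map. -/
noncomputable def incl {A B : CMod K lam Ω} (h : A ≤ B) : A.carrier ↪[L] B.carrier := h.choose

theorem isEmb_incl {A B : CMod K lam Ω} (h : A ≤ B) : K.IsEmb (incl h) := h.choose_spec.1

@[simp]
theorem coe_incl {A B : CMod K lam Ω} (h : A ≤ B) (x : A.carrier) : (incl h x : Ω) = x :=
  h.choose_spec.2 x

theorem subset_of_le {A B : CMod K lam Ω} (h : A ≤ B) : A.carrier ⊆ B.carrier := fun x hx => by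
  have := (incl h ⟨x, hx⟩).2
  rwa [coe_incl] at this

/-- Transport of a model to a subset of `Ω` along an injection. -/
theorem exists_of_injective {X : Type u} [L.Structure X] (hX : K.MemCard lam X) (φ : X → Ω)
    (hφ : Function.Injective φ) : ∃ (B : CMod K lam Ω) (g : X ≃[L] B.carrier),
      B.carrier = Set.range φ ∧ ∀ x, (g x : Ω) = φ x := by
  let e : X ≃ Set.range φ := Equiv.ofInjective φ hφ
  let : L.Structure (Set.range φ) := e.inducedStructure
  let g : X ≃[L] Set.range φ := e.inducedStructureEquiv
  exact ⟨⟨Set.range φ, K.mem_of_equiv g hX.1, (Cardinal.mk_congr e).symm.trans hX.2⟩, g, rfl,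
    fun _ => rfl⟩

/-- Every `K`-extension in `K_λ` of a model on a subset of `Ω` can be realized on a
larger subset of `Ω`. -/
theorem exists_ge_equiv (h0 : ℵ₀ ≤ lam) (hΩ : lam < #Ω) (A : CMod K lam Ω) {X : Type u}
    [L.Structure X] (hX : K.MemCard lam X) {e : A.carrier ↪[L] X} (he : K.IsEmb e) :
    ∃ (B : CMod K lam Ω) (_ : A ≤ B) (g : X ≃[L] B.carrier), ∀ x, (g (e x) : Ω) = x := by
  have : Infinite Ω := Cardinal.infinite_iff.2 (h0.trans hΩ.le)
  have hc : #(A.carrierᶜ : Set Ω) = #Ω := Cardinal.mk_compl_of_infinite _ (A.mem.2.trans_lt hΩ)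
  have hle : #X ≤ #(A.carrierᶜ : Set Ω) := by
    rw [hX.2, hc]
    exact hΩ.le
  obtain ⟨ψ⟩ := hle
  classical
  let φ : X → Ω := fun y => if h : ∃ x, e x = y then (h.choose : Ω) else ψ y
  have hφe : ∀ x, φ (e x) = x := fun x => by
    have h : ∃ x', e x' = e x := ⟨x, rfl⟩
    simp only [φ, dif_pos h]
    exact congrArg _ (e.injective h.choose_spec)
  have hφn : ∀ y, (¬ ∃ x, e x = y) → φ y = ψ y := fun y h => by
    simp only [φ, dif_neg h]
  have hinj : Function.Injective φ := by
    intro y y' hyy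
    by_cases h : ∃ x, e x = y <;> by_cases h' : ∃ x, e x = y'
    · obtain ⟨x, rfl⟩ := h
      obtain ⟨x', rfl⟩ := h'
      rw [hφe, hφe] at hyy
      rw [Subtype.ext hyy]
    · obtain ⟨x, rfl⟩ := h
      rw [hφe, hφn y' h'] at hyy
      exact absurd (hyy ▸ x.2) (ψ y').2
    · obtain ⟨x', rfl⟩ := h'
      rw [hφe, hφn y h] at hyy
      exact absurd (hyy ▸ x'.2) (ψ y).2
    · rw [hφn y h, hφn y' h'] at hyy
      exact ψ.injective (Subtype.ext hyy)
  obtain ⟨B, g, -, hg⟩ := exists_of_injective hX φ hinj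
  exact ⟨B, ⟨g.toEmbedding.comp e, isEmb_comp (isEmb_equiv g hX.1) he,
    fun x => (hg _).trans (hφe x)⟩, g, fun x => (hg _).trans (hφe x)⟩

/-- Unions of chains of at most `λ` models. -/
theorem exists_iUnion (h0 : ℵ₀ ≤ lam) {ι : Type u} [Nonempty ι] (hι : #ι ≤ lam)
    (A : ι → CMod K lam Ω) (htot : ∀ i j, A i ≤ A j ∨ A j ≤ A i) :
    ∃ U : CMod K lam Ω, U.carrier = ⋃ i, (A i).carrier ∧ ∀ i, A i ≤ U := by
  let : Preorder ι := Preorder.lift A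
  have : IsDirectedOrder ι := ⟨fun i j => (htot i j).elim (fun h => ⟨j, h, le_refl (A j)⟩)
    (fun h => ⟨i, le_refl (A i), h⟩)⟩
  let f : ∀ i j : ι, i ≤ j → (A i).carrier ↪[L] (A j).carrier := fun i j h => incl h
  have hf : ∀ i j h x, (f i j h x : Ω) = x := fun i j h x => coe_incl h x
  have : DirectedSystem (fun i => (A i).carrier) fun i j h => f i j h :=
    ⟨fun i x => Subtype.ext (hf _ _ _ _), fun i j k hij hjk x => Subtype.ext (by
      rw [hf, hf, hf])⟩
  let X := Language.DirectLimit (fun i => (A i).carrier) f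
  let o : ∀ i, (A i).carrier ↪[L] X := fun i => Language.DirectLimit.of L ι _ f i
  have ho : ∀ i j (h : i ≤ j) x, o j (f i j h x) = o i x := fun i j h x => Language.DirectLimit.of_f
  have hval : ∀ i j x y, o i x = o j y ↔ (x : Ω) = y := by
    have key : ∀ i j (_ : i ≤ j) x y, o i x = o j y ↔ (x : Ω) = y := fun i j h x y => by
      rw [← ho i j h x, (o j).injective.eq_iff, Subtype.ext_iff, hf]
    intro i j x y
    rcases htot i j with h | h
    · exact key i j h x y
    · rw [eq_comm, key j i h y x, eq_comm]
  have hex : ∀ z : X, ∃ i x, o i x = z := fun z => Language.DirectLimit.exists_of z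
  choose I Y hY using hex
  let φ : X → Ω := fun z => Y z
  have hφ : ∀ i x, φ (o i x) = x := fun i x => (hval _ _ _ _).1 (hY (o i x))
  have hinj : Function.Injective φ := fun z w h => by
    rw [← hY z, ← hY w]
    exact (hval _ _ _ _).2 h
  have hrange : Set.range φ = ⋃ i, (A i).carrier := by
    ext x
    rw [Set.mem_iUnion]
    constructor
    · rintro ⟨z, rfl⟩
      exact ⟨I z, (Y z).2⟩
    · rintro ⟨i, hx⟩
      exact ⟨o i ⟨x, hx⟩, hφ _ _⟩
  have hmono : ∀ i j, i ≤ j → (o i).toHom.range ≤ (o j).toHom.range := by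
    rintro i j h _ ⟨x, rfl⟩
    exact ⟨f i j h x, ho i j h x⟩
  have hmem : ∀ i, K.Mem (o i).toHom.range := fun i => K.mem_of_equiv (o i).equivRange (A i).mem.1
  obtain ⟨hXmem, hXst⟩ := K.chain_union (A := X) (Set.range fun i => (o i).toHom.range)
    (Set.range_nonempty _)
    (by
      rintro _ ⟨i, rfl⟩ _ ⟨j, rfl⟩ -
      exact (htot i j).imp (hmono i j) (hmono j i))
    (by
      rintro _ ⟨i, rfl⟩ _ ⟨j, rfl⟩ hle
      rcases htot i j with h | h
      · have h1 := K.strong_of_equiv (o j).equivRange (isEmb_incl h)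
        convert h1 using 1
        ext x
        obtain ⟨y, rfl⟩ := (o j).equivRange.surjective x
        simp only [Substructure.mem_comap, Substructure.mem_map]
        constructor
        · rintro ⟨z, hz⟩
          refine ⟨incl h z, ⟨z, rfl⟩, ?_⟩
          refine congrArg (o j).equivRange ((o j).injective ?_)
          exact (ho i j h z).trans hz
        · rintro ⟨_, ⟨z, rfl⟩, hz⟩
          have : incl h z = y := (o j).equivRange.injective hz
          subst this
          exact ⟨z, (ho i j h z).symm⟩
      · have h1 := K.strong_top (hmem j)
        convert h1 using 1
        ext x
        simp only [Substructure.mem_comap, Substructure.mem_top, iff_true]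
        exact hmono j i h x.2)
    (fun z => ⟨_, ⟨I z, rfl⟩, ⟨Y z, hY z⟩⟩)
  have hXcard : #X = lam := by
    refine le_antisymm ?_ ?_
    · rw [← Cardinal.mk_range_eq φ hinj, hrange]
      refine (Cardinal.mk_iUnion_le _).trans ?_
      refine Cardinal.mul_le_of_le h0 hι (ciSup_le' fun i => (A i).mem.2.le)
    · obtain ⟨i⟩ := (inferInstance : Nonempty ι)
      rw [← (A i).mem.2]
      exact Cardinal.mk_le_of_injective (o i).injective
  obtain ⟨U, g, hU, hg⟩ := exists_of_injective ⟨hXmem, hXcard⟩ φ hinj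
  refine ⟨U, hU.trans hrange, fun i => ⟨g.toEmbedding.comp (o i),
    isEmb_comp (isEmb_equiv g hXmem) (hXst _ ⟨i, rfl⟩), fun x => (hg _).trans (hφ i x)⟩⟩

end CMod

/-- The union of a compatible increasing family of `K`-embeddings is a `K`-embedding. -/
theorem AEC.exists_emb_iSup {K : AEC L} {N R : Type u} [L.Structure N] [L.Structure R] {ι : Type*}
    [LinearOrder ι] [Nonempty ι] (S : ι →o L.Substructure N) (F : N → R) (g : ∀ i, S i ↪[L] R)
    (hg : ∀ i, K.IsEmb (g i)) (hF : ∀ i x, g i x = F x) :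
    ∃ e : (⨆ i, S i : L.Substructure N) ↪[L] R, K.IsEmb e ∧ ∀ x, e x = F x := by
  let l := Language.DirectLimit.lift L ι (fun i => S i) (fun _ _ h => Substructure.inclusion (S.monotone h))
    g (fun i j hij x => (hF j _).trans (hF i x).symm)
  have hl : l.toHom.range = ⨆ i, (g i).toHom.range := Language.DirectLimit.range_lift _ _
  refine ⟨l.comp (Language.DirectLimit.Equiv_iSup S).symm.toEmbedding, ?_, fun x => ?_⟩
  · unfold IsEmb
    have : (l.comp (Language.DirectLimit.Equiv_iSup S).symm.toEmbedding).toHom.range = l.toHom.range := by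
      ext y
      simp only [Hom.mem_range]
      constructor
      · rintro ⟨x, rfl⟩
        exact ⟨_, rfl⟩
      · rintro ⟨x, rfl⟩
        exact ⟨Language.DirectLimit.Equiv_iSup S x, congrArg l
          ((Language.DirectLimit.Equiv_iSup S).symm_apply_apply x)⟩
    rw [this, hl]
    have hmono : ∀ i j, i ≤ j → (g i).toHom.range ≤ (g j).toHom.range := by
      rintro i j hij _ ⟨x, rfl⟩
      exact ⟨⟨x, S.monotone hij x.2⟩, (hF j _).trans (hF i x).symm⟩
    refine K.chain_smooth (Set.range fun i => (g i).toHom.range) (Set.range_nonempty _) ?_ ?_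
    · rintro _ ⟨i, rfl⟩ _ ⟨j, rfl⟩ -
      exact (le_total i j).imp (hmono i j) (hmono j i)
    · rintro _ ⟨i, rfl⟩
      exact hg i
  · obtain ⟨y, rfl⟩ := (Language.DirectLimit.Equiv_iSup S).surjective x
    obtain ⟨i, z, rfl⟩ := Language.DirectLimit.exists_of y
    have h1 : (l.comp (Language.DirectLimit.Equiv_iSup S).symm.toEmbedding)
        (Language.DirectLimit.Equiv_iSup S (Language.DirectLimit.of L ι _ _ i z)) = g i z := by
      refine (congrArg l ((Language.DirectLimit.Equiv_iSup S).symm_apply_apply _)).trans ?_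
      rfl
    rw [h1, hF]
    rfl

namespace CMod

variable {K : AEC L} {lam : Cardinal.{u}} {Ω : Type u}

/-- The substructure of `N` on the set `S` (generated by it, if `S` is not closed). -/
def sub (N : CMod K lam Ω) (S : Set Ω) : L.Substructure N.carrier :=
  Substructure.closure L (Subtype.val ⁻¹' S)

/-- The set `S` is the underlying set of a strong substructure of `N` of size `λ`. -/
structure Str (N : CMod K lam Ω) (S : Set Ω) : Prop where
  subset : S ⊆ N.carrier
  strong : K.Strong N.carrier (N.sub S)
  card : #(N.sub S) = lam
  mem_of_mem : ∀ x ∈ N.sub S, (x : Ω) ∈ S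

variable {N N' : CMod K lam Ω} {S T : Set Ω}

theorem Str.mem_sub (h : N.Str S) {x : N.carrier} : x ∈ N.sub S ↔ (x : Ω) ∈ S :=
  ⟨h.mem_of_mem x, fun hx => Substructure.subset_closure hx⟩

theorem sub_mono (h : S ⊆ T) : N.sub S ≤ N.sub T :=
  Substructure.closure_mono (Set.preimage_mono h)

theorem sub_image (V : L.Substructure N.carrier) : N.sub (Subtype.val '' (V : Set N.carrier)) = V := by
  unfold sub
  rw [Set.preimage_image_eq _ Subtype.val_injective, Substructure.closure_eq]

theorem str_image {V : L.Substructure N.carrier} (h : K.Strong N.carrier V) (hc : #V = lam) :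
    N.Str (Subtype.val '' (V : Set N.carrier)) :=
  ⟨fun _ ⟨x, _, hx⟩ => hx ▸ x.2, by rwa [sub_image], by rwa [sub_image], fun x hx => by
    rw [sub_image] at hx
    exact ⟨x, hx, rfl⟩⟩

theorem sub_carrier : N.sub N.carrier = ⊤ := by
  refine eq_top_iff.2 fun x _ => Substructure.subset_closure x.2

theorem str_carrier : N.Str N.carrier :=
  ⟨le_rfl, by rw [sub_carrier]; exact K.strong_top N.mem.1, by
    rw [sub_carrier]
    exact Cardinal.mk_univ.trans N.mem.2, fun x _ => x.2⟩

/-- The image of `S ∩ N` under a map `N → N'`, as a subset of `Ω`. -/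
def img (f : N.carrier ↪[L] N'.carrier) (S : Set Ω) : Set Ω :=
  {y | ∃ x : N.carrier, (x : Ω) ∈ S ∧ (f x : Ω) = y}

theorem img_mono {f : N.carrier ↪[L] N'.carrier} (h : S ⊆ T) : img f S ⊆ img f T :=
  fun _ ⟨x, hx, hy⟩ => ⟨x, h hx, hy⟩

theorem Str.img_eq (h : N.Str S) (f : N.carrier ↪[L] N'.carrier) :
    img f S = Subtype.val '' ((N.sub S).map f.toHom : Set N'.carrier) := by
  ext y
  constructor
  · rintro ⟨x, hx, rfl⟩
    exact ⟨f x, ⟨x, h.mem_sub.2 hx, rfl⟩, rfl⟩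
  · rintro ⟨_, ⟨x, hx, rfl⟩, rfl⟩
    exact ⟨x, h.mem_sub.1 hx, rfl⟩

theorem Str.sub_img (h : N.Str S) (f : N.carrier ↪[L] N'.carrier) :
    N'.sub (img f S) = (N.sub S).map f.toHom := by
  rw [h.img_eq, sub_image]

theorem Str.img (h : N.Str S) {f : N.carrier ↪[L] N'.carrier} (hf : K.IsEmb f) :
    N'.Str (img f S) := by
  rw [h.img_eq]
  exact str_image (Strong.map hf h.strong) ((mk_map f _).trans h.card)

theorem img_incl (h : N ≤ N') (hS : S ⊆ N.carrier) : img (incl h) S = S := by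
  ext y
  constructor
  · rintro ⟨x, hx, rfl⟩
    rwa [coe_incl]
  · intro hy
    exact ⟨⟨y, hS hy⟩, hy, coe_incl h _⟩

theorem Str.up (hS : N.Str S) (h : N ≤ N') : N'.Str S := by
  have := hS.img (isEmb_incl h)
  rwa [img_incl h hS.subset] at this

theorem str_iUnion {ι : Type*} [Nonempty ι] {B : ι → Set Ω} (hB : ∀ i, N.Str (B i))
    (htot : ∀ i j, B i ⊆ B j ∨ B j ⊆ B i) :
    N.Str (⋃ i, B i) ∧ N.sub (⋃ i, B i) = sSup (Set.range fun i => N.sub (B i)) := by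
  have hch : IsChain (· ≤ ·) (Set.range fun i => N.sub (B i)) := by
    rintro _ ⟨i, rfl⟩ _ ⟨j, rfl⟩ -
    exact (htot i j).imp sub_mono sub_mono
  have hst : K.Strong N.carrier (sSup (Set.range fun i => N.sub (B i))) := by
    refine K.chain_smooth _ (Set.range_nonempty _) hch ?_
    rintro _ ⟨i, rfl⟩
    exact (hB i).strong
  have hcard : #(sSup (Set.range fun i => N.sub (B i)) : L.Substructure N.carrier) = lam := by
    obtain ⟨i⟩ := (inferInstance : Nonempty ι)
    exact FrameData.mk_eq_of_between (S := N.sub (B i)) (le_sSup ⟨i, rfl⟩) (hB i).card N.mem.2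
  have himg : Subtype.val '' ((sSup (Set.range fun i => N.sub (B i)) : L.Substructure N.carrier) :
      Set N.carrier) = ⋃ i, B i := by
    ext x
    rw [Set.mem_iUnion]
    constructor
    · rintro ⟨y, hy, rfl⟩
      rw [SetLike.mem_coe, Substructure.mem_sSup_of_directedOn (Set.range_nonempty _)
        hch.directedOn] at hy
      obtain ⟨_, ⟨i, rfl⟩, hy⟩ := hy
      exact ⟨i, (hB i).mem_of_mem y hy⟩
    · rintro ⟨i, hx⟩
      refine ⟨⟨x, (hB i).subset hx⟩, ?_, rfl⟩
      have hle : N.sub (B i) ≤ sSup (Set.range fun i => N.sub (B i)) := le_sSup ⟨i, rfl⟩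
      exact hle ((Str.mem_sub (hB i) (x := ⟨x, (hB i).subset hx⟩)).2 hx)
  rw [← himg, sub_image]
  exact ⟨str_image hst hcard, rfl⟩

/-- `a` is free from `B` over `A` in `N`, for subsets `A`, `B` and an element `a` of `Ω`. -/
structure Fr (s : FrameData K) (N : CMod K lam Ω) (A B : Set Ω) (a : Ω) : Prop where
  left : N.Str A
  right : N.Str B
  mem : a ∈ N.carrier
  nf : s.nf (N.sub A) (N.sub B) (single ⟨a, mem⟩)

variable {s : FrameData K} {A B : Set Ω} {a : Ω}

theorem fr_of_nf (hp : s.IsPreFrame 2 lam) {V W : L.Substructure N.carrier} {x : N.carrier}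
    (H : s.nf V W (single x)) :
    Fr s N (Subtype.val '' (V : Set N.carrier)) (Subtype.val '' (W : Set N.carrier)) x := by
  have d := hp.nf_dom _ _ _ H
  refine ⟨str_image d.1.1 d.1.2.1, str_image d.2.1.1 d.2.1.2.1, x.2, ?_⟩
  rwa [sub_image, sub_image]

theorem Fr.img (hp : s.IsPreFrame 2 lam) (H : Fr s N A B a) {f : N.carrier ↪[L] N'.carrier}
    (hf : K.IsEmb f) : Fr s N' (img f A) (img f B) (f ⟨a, H.mem⟩) := by
  rw [H.left.img_eq, H.right.img_eq]
  exact fr_of_nf hp (hp.nf_map H.nf hf N'.mem.2)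

theorem Fr.up (hp : s.IsPreFrame 2 lam) (H : Fr s N A B a) (h : N ≤ N') : Fr s N' A B a := by
  have := H.img hp (isEmb_incl h)
  rwa [img_incl h H.left.subset, img_incl h H.right.subset, coe_incl] at this

theorem Fr.mono (hp : s.IsPreFrame 2 lam) (H : Fr s N A B a) {A' : Set Ω} (hA : N.Str A')
    (h1 : A ⊆ A') (h2 : A' ⊆ B) : Fr s N A' B a :=
  ⟨hA, H.right, H.mem, hp.nf_mono H.nf (sub_mono h1) (sub_mono h2) le_rfl hA.strong H.right.strong⟩

theorem Fr.trans (hs : s.IsGoodMinusSt 2 lam) {C : Set Ω} (H : Fr s N A B a) (H' : Fr s N B C a) :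
    Fr s N A C a :=
  ⟨H.left, H'.right, H.mem, hs.nf_trans H.nf H'.nf⟩

theorem Fr.subset (hp : s.IsPreFrame 2 lam) (H : Fr s N A B a) : A ⊆ B := fun x hx =>
  H.right.mem_sub.1 ((hp.nf_dom _ _ _ H.nf).2.2.1
    ((Str.mem_sub H.left (x := ⟨x, H.left.subset hx⟩)).2 hx))

theorem Fr.notMem (hp : s.IsPreFrame 2 lam) (H : Fr s N A B a) : a ∉ B := fun h =>
  hp.notMem_of_nf H.nf (H.right.mem_sub.2 h)

theorem fr_iUnion (hs : s.IsGoodMinusSt 2 lam) {ι : Type*} [Nonempty ι] {B : ι → Set Ω}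
    (hB : ∀ i, Fr s N A (B i) a) (htot : ∀ i j, B i ⊆ B j ∨ B j ⊆ B i) :
    Fr s N A (⋃ i, B i) a := by
  obtain ⟨h1, h2⟩ := str_iUnion (fun i => (hB i).right) htot
  obtain ⟨i⟩ := (inferInstance : Nonempty ι)
  refine ⟨(hB i).left, h1, (hB i).mem, ?_⟩
  rw [h2]
  refine hs.nf_sSup (Set.range_nonempty _) ?_ ?_
  · rintro _ ⟨i, rfl⟩ _ ⟨j, rfl⟩ -
    exact (htot i j).imp sub_mono sub_mono
  · rintro _ ⟨i, rfl⟩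
    exact (hB i).nf

end CMod

end

section

/-! ### Independent chains -/

open AEC CMod

variable {L : FirstOrder.Language.{u, u}} {K : AEC L} {lam : Cardinal.{u}} {Ω : Type u}

/-- A model `N` with an increasing continuous chain `⟨C j : j ≤ κ⟩` of strong submodels such that
`a j ∈ C (j + 1)` is free from `C j` over `M`, for `j < κ`. -/
structure IndepChain (s : FrameData K) (lam : Cardinal.{u}) (M : Set Ω) (a : Ordinal.{u} → Ω)
    (κ : Ordinal.{u}) where
  N : CMod K lam Ω
  C : Ordinal.{u} → Set Ω
  str : ∀ j ≤ κ, N.Str (C j)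
  mono : ∀ i j, i ≤ j → j ≤ κ → C i ⊆ C j
  cont : ∀ j ≤ κ, Order.IsSuccLimit j → ∀ x ∈ C j, ∃ i < j, x ∈ C i
  mem : ∀ j < κ, a j ∈ C (Order.succ j)
  fr : ∀ j < κ, Fr s N M (C j) (a j)

namespace IndepChain

variable {s : FrameData K} {M : Set Ω} {a : Ordinal.{u} → Ω} {κ : Ordinal.{u}}

/-- `t ≤ t'` if both the ambient model and each member of the chain grow. -/
instance : Preorder (IndepChain s lam M a κ) where
  le t t' := t.N ≤ t'.N ∧ ∀ j ≤ κ, t.C j ⊆ t'.C j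
  le_refl t := ⟨le_rfl, fun _ _ => le_rfl⟩
  le_trans _ _ _ h h' := ⟨h.1.trans h'.1, fun j hj => (h.2 j hj).trans (h'.2 j hj)⟩

/-- Chains of independent chains have upper bounds. -/
theorem exists_iUnion (hs : s.IsGoodMinusSt 2 lam) {ι : Type u} [Nonempty ι] (hι : #ι ≤ lam)
    (t : ι → IndepChain s lam M a κ) (htot : ∀ i j, t i ≤ t j ∨ t j ≤ t i) :
    ∃ t' : IndepChain s lam M a κ, (∀ i, t i ≤ t') ∧ t'.N.carrier ⊆ ⋃ i, (t i).N.carrier := by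
  obtain ⟨U, hU, hle⟩ := CMod.exists_iUnion (aleph0_le_of_LS hs.pre.ls_le) hι (fun i => (t i).N)
    (fun i j => (htot i j).imp And.left And.left)
  have htotC : ∀ k ≤ κ, ∀ i j, (t i).C k ⊆ (t j).C k ∨ (t j).C k ⊆ (t i).C k := fun k hk i j =>
    (htot i j).imp (fun h => h.2 k hk) (fun h => h.2 k hk)
  obtain ⟨i₀⟩ := (inferInstance : Nonempty ι)
  refine ⟨⟨U, fun j => ⋃ i, (t i).C j, fun j hj => ?_, fun i j hij hj => ?_, fun j hj hl x hx => ?_,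
    fun j hj => ?_, fun j hj => ?_⟩,
    fun i => ⟨hle i, fun j _ => Set.subset_iUnion (fun i => (t i).C j) i⟩, hU.le⟩
  · exact (str_iUnion (fun i => ((t i).str j hj).up (hle i)) (htotC j hj)).1
  · exact Set.iUnion_mono fun k => (t k).mono i j hij hj
  · obtain ⟨k, hk⟩ := Set.mem_iUnion.1 hx
    obtain ⟨i, hi, hx⟩ := (t k).cont j hj hl x hk
    exact ⟨i, hi, Set.mem_iUnion.2 ⟨k, hx⟩⟩
  · exact Set.mem_iUnion.2 ⟨i₀, (t i₀).mem j hj⟩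
  · exact fr_iUnion hs (fun i => ((t i).fr j hj).up hs.pre (hle i)) (htotC j hj.le)

end IndepChain

/-! ### Catching an element: the recursion along the chain -/

/-- An approximation to an extension of the independent chain `t` that contains `c` from level `n`
on. It consists of models `⟨D j : n ≤ j ≤ i⟩` with union `R`, and of a `K`-embedding `h` of `C i`
into `R` that maps each `C j` into `D j`, such that `h (a j)` is free from `D j` over `h[C j]` and
`c ∈ D n` is free from `h[C i]` over `C n`. -/
structure PartialExt {s : FrameData K} {M : Set Ω} {a : Ordinal.{u} → Ω} {κ : Ordinal.{u}}
    (t : IndepChain s lam M a κ) (n : Ordinal.{u}) (c : Ω) where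
  i : Ordinal.{u}
  n_le : n ≤ i
  le_κ : i ≤ κ
  R : CMod K lam Ω
  D : Ordinal.{u} → Set Ω
  h : Ω → Ω
  N_le : t.N ≤ R
  emb : ∃ e : t.N.sub (t.C i) ↪[L] R.carrier, K.IsEmb e ∧ ∀ x, (e x : Ω) = h x
  h_id : ∀ x ∈ t.C n, h x = x
  str : ∀ j, n ≤ j → j ≤ i → R.Str (D j)
  mono : ∀ j k, n ≤ j → j ≤ k → k ≤ i → D j ⊆ D k
  cont : ∀ j, n < j → j ≤ i → Order.IsSuccLimit j → ∀ x ∈ D j, ∃ k, n ≤ k ∧ k < j ∧ x ∈ D k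
  bot : c ∈ D n
  top : D i = R.carrier
  image_subset : ∀ j, n ≤ j → j ≤ i → h '' t.C j ⊆ D j
  fr_c : Fr s R (t.C n) (h '' t.C i) c
  fr_a : ∀ j, n ≤ j → j < i → Fr s R (h '' t.C j) (D j) (h (a j))

namespace PartialExt

variable {s : FrameData K} {M : Set Ω} {a : Ordinal.{u} → Ω} {κ : Ordinal.{u}}
  {t : IndepChain s lam M a κ} {n : Ordinal.{u}} {c : Ω}

/-- `q` continues `p`. -/
instance : Preorder (PartialExt t n c) where
  le p q := p.i ≤ q.i ∧ p.R ≤ q.R ∧ (∀ j, n ≤ j → j ≤ p.i → p.D j = q.D j) ∧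
    ∀ x ∈ t.C p.i, p.h x = q.h x
  le_refl p := ⟨le_rfl, le_rfl, fun _ _ _ => rfl, fun _ _ => rfl⟩
  le_trans p q r h h' := ⟨h.1.trans h'.1, h.2.1.trans h'.2.1,
    fun j hn hj => (h.2.2.1 j hn hj).trans (h'.2.2.1 j hn (hj.trans h.1)),
    fun x hx => (h.2.2.2 x hx).trans (h'.2.2.2 x (t.mono _ _ h.1 q.le_κ hx))⟩

/-- The initial approximation, with `D n = N`. -/
theorem nonempty_of_fr (hs : s.IsGoodMinusSt 2 lam) (hn : n ≤ κ)
    (hc : Fr s t.N (t.C n) (t.C κ) c) : Nonempty (PartialExt t n c) := by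
  have hself : Fr s t.N (t.C n) (t.C n) c := ⟨hc.left, hc.left, hc.mem,
    hs.pre.nf_mono hc.nf le_rfl le_rfl (sub_mono (t.mono n κ hn le_rfl)) hc.left.strong
      hc.left.strong⟩
  have heq : ∀ j, n ≤ j → j ≤ n → j = n := fun j h h' => le_antisymm h' h
  exact ⟨{
    i := n
    n_le := le_rfl
    le_κ := hn
    R := t.N
    D := fun _ => t.N.carrier
    h := id
    N_le := le_rfl
    emb := ⟨(t.N.sub (t.C n)).subtype, isEmb_subtype hc.left.strong, fun _ => rfl⟩
    h_id := fun _ _ => rfl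
    str := fun _ _ _ => str_carrier
    mono := fun _ _ _ _ _ => le_rfl
    cont := fun j h1 h2 _ _ _ => absurd h1 h2.not_gt
    bot := hc.mem
    top := rfl
    image_subset := fun j h1 h2 => by
      rw [heq j h1 h2, Set.image_id]
      exact hc.left.subset
    fr_c := by rwa [Set.image_id]
    fr_a := fun j h1 h2 => absurd h1 h2.not_ge }⟩

theorem image_eq {R : CMod K lam Ω} {h : Ω → Ω} {S : Set Ω} (hS : t.N.Str S)
    {e : t.N.sub S ↪[L] R.carrier} (he : ∀ x, (e x : Ω) = h x) :
    Subtype.val '' (e.toHom.range : Set R.carrier) = h '' S := by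
  ext y
  constructor
  · rintro ⟨_, ⟨x, rfl⟩, rfl⟩
    exact ⟨x, hS.mem_of_mem _ x.2, (he x).symm⟩
  · rintro ⟨x, hx, rfl⟩
    have hx' : (⟨x, hS.subset hx⟩ : t.N.carrier) ∈ t.N.sub S := hS.mem_sub.2 hx
    exact ⟨e ⟨_, hx'⟩, ⟨_, rfl⟩, he _⟩

theorem sub_image_eq {R : CMod K lam Ω} {h : Ω → Ω} {S : Set Ω} (hS : t.N.Str S)
    {e : t.N.sub S ↪[L] R.carrier} (he : ∀ x, (e x : Ω) = h x) :
    R.sub (h '' S) = e.toHom.range := by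
  rw [← image_eq hS he, sub_image]

/-- The successor step: symmetric amalgamation of `C (i + 1)` and `R` over `C i`. -/
theorem exists_gt (hs : s.IsGoodMinusSt 2 lam) (hΩ : lam < #Ω) (p : PartialExt t n c)
    (hi : p.i < κ) : ∃ q : PartialExt t n c, p ≤ q ∧ p.i < q.i := by
  have h0 := aleph0_le_of_LS hs.pre.ls_le
  set i := p.i with hidef
  have hi1 : Order.succ i ≤ κ := Order.succ_le_of_lt hi
  have hSi := t.str i hi.le
  have hSi1 := t.str (Order.succ i) hi1
  have hCC : t.C i ⊆ t.C (Order.succ i) := t.mono _ _ (Order.le_succ i) hi1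
  obtain ⟨e, he, heh⟩ := p.emb
  let e₁ : t.N.sub (t.C i) ↪[L] t.N.sub (t.C (Order.succ i)) :=
    Substructure.inclusion (sub_mono hCC)
  have he₁ : K.IsEmb e₁ := isEmb_inclusion _ hSi.strong hSi1.strong
  have hai : (⟨a i, (t.fr i hi).mem⟩ : t.N.carrier) ∈ t.N.sub (t.C (Order.succ i)) :=
    (Str.mem_sub hSi1 (x := ⟨a i, (t.fr i hi).mem⟩)).2 (t.mem i hi)
  let ai : t.N.sub (t.C (Order.succ i)) := ⟨⟨a i, (t.fr i hi).mem⟩, hai⟩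
  have hr₁ : e₁.toHom.range.map (t.N.sub (t.C (Order.succ i))).subtype.toHom
      = t.N.sub (t.C i) := by
    rw [← FrameData.range_comp_eq_map, Substructure.subtype_comp_inclusion, Substructure.range_subtype]
  have ha : s.nf e₁.toHom.range e₁.toHom.range (single ai) := by
    refine hs.pre.nf_of_map (isEmb_subtype hSi1.strong) hSi1.card ?_
    rw [hr₁]
    exact hs.pre.nf_mono (t.fr i hi).nf (sub_mono ((t.fr i hi).subset hs.pre)) le_rfl le_rfl
      hSi.strong hSi.strong
  have hc : s.nf e.toHom.range e.toHom.range (single (⟨c, p.fr_c.mem⟩ : p.R.carrier)) := by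
    have := p.fr_c.nf
    rw [sub_image_eq hSi heh] at this
    exact hs.pre.nf_mono this (hs.pre.nf_dom _ _ _ this).2.2.1 le_rfl le_rfl he he
  obtain ⟨Q, _, f, g, hQ, hf, hg, hfg, hna, hnc⟩ := hs.exists_symmetric_amalgam he₁ he ha hc
  obtain ⟨R', hRR', k, hk⟩ := exists_ge_equiv h0 hΩ p.R hQ hg
  have hkE : K.IsEmb k.toEmbedding := isEmb_equiv k hQ.1
  let e' : t.N.sub (t.C (Order.succ i)) ↪[L] R'.carrier := k.toEmbedding.comp f
  have he' : K.IsEmb e' := isEmb_comp hkE hf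
  classical
  let h' : Ω → Ω := fun x => if hx : ∃ y : t.N.sub (t.C (Order.succ i)), (y : Ω) = x then
    (e' hx.choose : Ω) else x
  have heh' : ∀ x, (e' x : Ω) = h' x := fun x => by
    have hx : ∃ y : t.N.sub (t.C (Order.succ i)), (y : Ω) = x := ⟨x, rfl⟩
    simp only [h', dif_pos hx]
    congr 2
    exact Subtype.ext (Subtype.ext hx.choose_spec.symm)
  have hee : ∀ x, (e' (e₁ x) : Ω) = e x := fun x => by
    have h1 : e' (e₁ x) = k (g (e x)) := congrArg k (hfg x)
    rw [h1, hk]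
  have hhh : ∀ x ∈ t.C i, p.h x = h' x := fun x hx => by
    have hx' : (⟨x, hSi.subset hx⟩ : t.N.carrier) ∈ t.N.sub (t.C i) :=
      (Str.mem_sub hSi (x := ⟨x, hSi.subset hx⟩)).2 hx
    have h1 := heh ⟨_, hx'⟩
    have h2 := heh' (e₁ ⟨_, hx'⟩)
    rw [hee] at h2
    exact h1.symm.trans h2
  have himg : ∀ j ≤ i, h' '' t.C j = p.h '' t.C j := fun j hj =>
    Set.image_congr fun x hx => (hhh x (t.mono j i hj hi.le hx)).symm
  have hbase : (f.comp e₁).toHom.range.map k.toEmbedding.toHom = R'.sub (h' '' t.C i) := by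
    rw [himg i le_rfl, ← image_eq hSi heh, ← FrameData.range_comp_eq_map]
    have h1 : k.toEmbedding.comp (f.comp e₁) = (incl hRR').comp e := by
      refine Embedding.ext fun x => Subtype.ext ?_
      exact (hee x).trans (coe_incl hRR' _).symm
    rw [h1, FrameData.range_comp_eq_map]
    have h2 : p.R.Str (Subtype.val '' (e.toHom.range : Set p.R.carrier)) :=
      str_image he ((mk_range e).trans hSi.card)
    have h3 := h2.sub_img (incl hRR')
    rw [img_incl hRR' h2.subset, sub_image] at h3
    exact h3.symm
  have hStrB : R'.Str (h' '' t.C i) := by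
    have h2 : p.R.Str (Subtype.val '' (e.toHom.range : Set p.R.carrier)) :=
      str_image he ((mk_range e).trans hSi.card)
    rw [himg i le_rfl, ← image_eq hSi heh]
    exact h2.up hRR'
  have hStrT : R'.Str (h' '' t.C (Order.succ i)) := by
    rw [← image_eq hSi1 heh']
    exact str_image he' ((mk_range e').trans hSi1.card)
  have hcR' : c ∈ R'.carrier := subset_of_le hRR' p.fr_c.mem
  have hfc : Fr s R' (h' '' t.C i) (h' '' t.C (Order.succ i)) c := by
    refine ⟨hStrB, hStrT, hcR', ?_⟩
    have h1 := hs.pre.nf_map hnc hkE R'.mem.2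
    rw [hbase, ← FrameData.range_comp_eq_map] at h1
    have h2 : k.toEmbedding (g ⟨c, p.fr_c.mem⟩) = ⟨c, hcR'⟩ := Subtype.ext (hk _)
    rw [h2] at h1
    rw [sub_image_eq hSi1 heh']
    exact h1
  have hfa : Fr s R' (h' '' t.C i) p.R.carrier (h' (a i)) := by
    have h1 := hs.pre.nf_map hna hkE R'.mem.2
    rw [hbase, ← FrameData.range_comp_eq_map] at h1
    have h2 : k.toEmbedding.comp g = incl hRR' :=
      Embedding.ext fun x => Subtype.ext ((hk x).trans (coe_incl hRR' _).symm)
    have h3 := (str_carrier (N := p.R)).sub_img (incl hRR')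
    rw [img_incl hRR' le_rfl, sub_carrier, ← Hom.range_eq_map] at h3
    rw [h2, ← h3] at h1
    have h4 : (e' ai : Ω) = h' (a i) := heh' ai
    refine ⟨hStrB, str_carrier.up hRR', h4 ▸ (e' ai).2, ?_⟩
    have h5 : (⟨h' (a i), h4 ▸ (e' ai).2⟩ : R'.carrier) = k.toEmbedding (f ai) :=
      Subtype.ext h4.symm
    rw [h5]
    exact h1
  have hsucc : ∀ j, j ≤ Order.succ i → ¬ j ≤ i → j = Order.succ i := fun j h1 h2 =>
    le_antisymm h1 (Order.succ_le_of_lt (not_le.1 h2))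
  let D' : Ordinal.{u} → Set Ω := fun j => if j ≤ i then p.D j else R'.carrier
  have hD'1 : ∀ j, j ≤ i → D' j = p.D j := fun j hj => if_pos hj
  have hD'2 : ∀ j, ¬ j ≤ i → D' j = R'.carrier := fun j hj => if_neg hj
  have hni : ¬ Order.succ i ≤ i := (Order.lt_succ i).not_ge
  refine ⟨{
    i := Order.succ i
    n_le := p.n_le.trans (Order.le_succ i)
    le_κ := hi1
    R := R'
    D := D'
    h := h'
    N_le := p.N_le.trans hRR'
    emb := ⟨e', he', heh'⟩
    h_id := fun x hx => (hhh x (t.mono _ _ p.n_le p.le_κ hx)).symm.trans (p.h_id x hx)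
    str := fun j hnj hj => ?_
    mono := fun j l hnj hjl hl => ?_
    cont := fun j hnj hj hlim x hx => ?_
    bot := ?_
    top := hD'2 _ hni
    image_subset := fun j hnj hj => ?_
    fr_c := ?_
    fr_a := fun j hnj hj => ?_ }, ⟨Order.le_succ i, hRR', fun j _ hj => (hD'1 j hj).symm, hhh⟩,
      Order.lt_succ i⟩
  · by_cases h : j ≤ i
    · rw [hD'1 j h]
      exact (p.str j hnj h).up hRR'
    · rw [hD'2 j h]
      exact str_carrier
  · by_cases h : l ≤ i
    · rw [hD'1 l h, hD'1 j (hjl.trans h)]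
      exact p.mono j l hnj hjl h
    · rw [hD'2 l h]
      by_cases h1 : j ≤ i
      · rw [hD'1 j h1]
        exact ((p.str j hnj h1).up hRR').subset
      · rw [hD'2 j h1]
  · by_cases h : j ≤ i
    · rw [hD'1 j h] at hx
      obtain ⟨l, h1, h2, h3⟩ := p.cont j hnj h hlim x hx
      refine ⟨l, h1, h2, ?_⟩
      rwa [hD'1 l (h2.le.trans h)]
    · exact absurd hlim (hsucc j hj h ▸ Order.not_isSuccLimit_succ i)
  · rw [hD'1 n p.n_le]
    exact p.bot
  · by_cases h : j ≤ i
    · rw [hD'1 j h, himg j h]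
      exact p.image_subset j hnj h
    · rw [hD'2 j h, hsucc j hj h]
      exact hStrT.subset
  · have := p.fr_c.up hs.pre hRR'
    rw [← hidef, ← himg i le_rfl] at this
    exact this.trans hs hfc
  · rcases (Order.lt_succ_iff.1 hj).lt_or_eq with h | rfl
    · rw [hD'1 j h.le, himg j h.le, ← hhh _ (t.mono _ _ (Order.succ_le_of_lt h) hi.le
        (t.mem j (h.trans hi)))]
      exact (p.fr_a j hnj h).up hs.pre hRR'
    · rw [hD'1 _ le_rfl, p.top]
      exact hfa

end PartialExt

namespace PartialExt

variable {s : FrameData K} {M : Set Ω} {a : Ordinal.{u} → Ω} {κ : Ordinal.{u}}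
  {t : IndepChain s lam M a κ} {n : Ordinal.{u}} {c : Ω}

/-- The limit step: the union of a chain of approximations without a last member. -/
theorem exists_limit (hs : s.IsGoodMinusSt 2 lam) (hκ : κ.card ≤ lam)
    {𝒞 : Set (PartialExt t n c)} (hne : 𝒞.Nonempty)
    (hle : ∀ p ∈ 𝒞, ∀ q ∈ 𝒞, p.i ≤ q.i → p ≤ q) (hmax : ∀ p ∈ 𝒞, ∃ q ∈ 𝒞, p.i < q.i) :
    ∃ q : PartialExt t n c, ∀ p ∈ 𝒞, p ≤ q ∧ p.i < q.i := by
  classical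
  have h0 := aleph0_le_of_LS hs.pre.ls_le
  let σ : Ordinal.{u} := sSup ((fun p : PartialExt t n c => p.i) '' 𝒞)
  have hbdd : BddAbove ((fun p : PartialExt t n c => p.i) '' 𝒞) :=
    ⟨κ, by rintro _ ⟨p, -, rfl⟩; exact p.le_κ⟩
  have hlt : ∀ p ∈ 𝒞, p.i < σ := fun p hp => by
    obtain ⟨q, hq, hpq⟩ := hmax p hp
    exact hpq.trans_le (le_csSup hbdd ⟨q, hq, rfl⟩)
  have hex : ∀ j, j < σ → ∃ p ∈ 𝒞, j < p.i := fun j hj => by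
    obtain ⟨_, ⟨p, hp, rfl⟩, h⟩ := exists_lt_of_lt_csSup (hne.image _) hj
    exact ⟨p, hp, h⟩
  have hσκ : σ ≤ κ := csSup_le (hne.image _) (by rintro _ ⟨p, -, rfl⟩; exact p.le_κ)
  obtain ⟨p₀, hp₀⟩ := hne
  have hnσ : n < σ := p₀.n_le.trans_lt (hlt p₀ hp₀)
  have hσlim : Order.IsSuccLimit σ := by
    rw [Order.isSuccLimit_iff]
    refine ⟨fun h => h.not_lt hnσ, ?_⟩
    rw [Order.isSuccPrelimit_iff_succ_lt]
    intro j hj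
    obtain ⟨p, hp, h⟩ := hex j hj
    exact (Order.succ_le_of_lt h).trans_lt (hlt p hp)
  choose P hP hPi using fun j : Set.Iio σ => hex j j.2
  let S : Type u := σ.ToType
  let idx : S ≃o Set.Iio σ := Ordinal.ToType.mk.symm
  have : Nonempty S := ⟨idx.symm ⟨n, hnσ⟩⟩
  have hS : #S ≤ lam := by
    rw [Cardinal.mk_toType]
    exact (Ordinal.card_le_card hσκ).trans hκ
  have htot : ∀ p ∈ 𝒞, ∀ q ∈ 𝒞, p ≤ q ∨ q ≤ p := fun p hp q hq =>
    (le_total p.i q.i).imp (hle p hp q hq) (hle q hq p hp)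
  obtain ⟨R, hR, hRle⟩ := CMod.exists_iUnion h0 hS (fun j => (P (idx j)).R)
    (fun i j => (htot _ (hP _) _ (hP _)).imp (fun h => h.2.1) (fun h => h.2.1))
  have hRle' : ∀ j, (P j).R ≤ R := fun j => by
    have := hRle (idx.symm j)
    simpa using this
  have hRP : ∀ p ∈ 𝒞, p.R ≤ R := fun p hp =>
    (hle p hp _ (hP _) (hPi ⟨p.i, hlt p hp⟩).le).2.1.trans (hRle' _)
  let D : Ordinal.{u} → Set Ω := fun j => if hj : j < σ then (P ⟨j, hj⟩).D j else R.carrier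
  have hD : ∀ p ∈ 𝒞, ∀ j, n ≤ j → j ≤ p.i → D j = p.D j := fun p hp j hnj hj => by
    have hjσ := hj.trans_lt (hlt p hp)
    simp only [D, dif_pos hjσ]
    rcases htot p hp _ (hP ⟨j, hjσ⟩) with h | h
    · exact (h.2.2.1 j hnj hj).symm
    · exact h.2.2.1 j hnj (hPi ⟨j, hjσ⟩).le
  have hDσ : ∀ j, ¬ j < σ → D j = R.carrier := fun j hj => dif_neg hj
  let h : Ω → Ω := fun x => if hx : ∃ p ∈ 𝒞, x ∈ t.C p.i then hx.choose.h x else x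
  have hh : ∀ p ∈ 𝒞, ∀ x ∈ t.C p.i, p.h x = h x := fun p hp x hxp => by
    have hx : ∃ p ∈ 𝒞, x ∈ t.C p.i := ⟨p, hp, hxp⟩
    simp only [h, dif_pos hx]
    rcases htot p hp _ hx.choose_spec.1 with h' | h'
    · exact h'.2.2.2 x hxp
    · exact (h'.2.2.2 x hx.choose_spec.2).symm
  have himg : ∀ p ∈ 𝒞, ∀ j ≤ p.i, h '' t.C j = p.h '' t.C j := fun p hp j hj =>
    Set.image_congr fun x hx => (hh p hp x (t.mono j _ hj p.le_κ hx)).symm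
  have hCσ : t.C σ = ⋃ j : Set.Iio σ, t.C (P j).i := by
    ext x
    rw [Set.mem_iUnion]
    constructor
    · intro hx
      obtain ⟨j, hj, hx⟩ := t.cont σ hσκ hσlim x hx
      exact ⟨⟨j, hj⟩, t.mono _ _ (hPi ⟨j, hj⟩).le (P _).le_κ hx⟩
    · rintro ⟨j, hx⟩
      exact t.mono _ _ (hlt _ (hP j)).le hσκ hx
  have hemb : ∃ e : t.N.sub (t.C σ) ↪[L] R.carrier, K.IsEmb e ∧ ∀ x, (e x : Ω) = h x := by
    -- the stage `p.i` is replaced by the monotone family of all stages below `σ`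
    let T : Set.Iio σ →o L.Substructure t.N.carrier :=
      ⟨fun j => t.N.sub (t.C j), fun i j hij => sub_mono (t.mono _ _ hij (j.2.le.trans hσκ))⟩
    have : Nonempty (Set.Iio σ) := ⟨⟨n, hnσ⟩⟩
    have hTσ : (⨆ j, T j) = t.N.sub (t.C σ) := by
      refine le_antisymm (iSup_le fun j => sub_mono (t.mono _ _ j.2.le hσκ)) fun x hx => ?_
      obtain ⟨j, hj, hx⟩ := t.cont σ hσκ hσlim x ((t.str σ hσκ).mem_sub.1 hx)
      exact le_iSup T ⟨j, hj⟩ ((t.str j (hj.le.trans hσκ)).mem_sub.2 hx)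
    have hg : ∀ j : Set.Iio σ, ∃ g : T j ↪[L] R.carrier, K.IsEmb g ∧ ∀ x, (g x : Ω) = h x := by
      intro j
      obtain ⟨e, he, heh⟩ := (P j).emb
      have hj : t.C j ⊆ t.C (P j).i := t.mono _ _ (hPi j).le (P j).le_κ
      refine ⟨(incl (hRle' j)).comp (e.comp (Substructure.inclusion (sub_mono hj))),
        isEmb_comp (isEmb_incl _) (isEmb_comp he (isEmb_inclusion _
          (t.str _ (j.2.le.trans hσκ)).strong (t.str _ (P j).le_κ).strong)), fun x => ?_⟩
      refine (coe_incl _ _).trans ((heh _).trans ?_)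
      exact hh _ (hP j) _ (hj ((t.str _ (j.2.le.trans hσκ)).mem_sub.1 x.2))
    choose g hgE hgh using hg
    have hmemR : ∀ x ∈ t.C σ, h x ∈ R.carrier := fun x hx => by
      obtain ⟨j, hj, hx⟩ := t.cont σ hσκ hσlim x hx
      have hStr := t.str j (hj.le.trans hσκ)
      have := hgh ⟨j, hj⟩ ⟨⟨x, hStr.subset hx⟩, hStr.mem_sub.2 hx⟩
      exact this ▸ (g ⟨j, hj⟩ _).2
    let F : t.N.carrier → R.carrier := fun x =>
      if hx : h x ∈ R.carrier then ⟨h x, hx⟩ else ⟨c, subset_of_le (hRP p₀ hp₀) p₀.fr_c.mem⟩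
    have hF : ∀ x ∈ t.N.sub (t.C σ), (F x : Ω) = h x := fun x hx => by
      simp only [F, dif_pos (hmemR x ((t.str σ hσκ).mem_sub.1 hx))]
    obtain ⟨e, he, heF⟩ := exists_emb_iSup T F g hgE (fun j x => Subtype.ext
      ((hgh j x).trans (hF x (hTσ ▸ le_iSup T j x.2)).symm))
    have hfin : ∃ e : (⨆ j, T j : L.Substructure t.N.carrier) ↪[L] R.carrier,
        K.IsEmb e ∧ ∀ x, (e x : Ω) = h x :=
      ⟨e, he, fun x => (congrArg Subtype.val (heF x)).trans (hF x (hTσ ▸ x.2))⟩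
    rwa [hTσ] at hfin
  have htotC : ∀ i j : Set.Iio σ, h '' t.C (P i).i ⊆ h '' t.C (P j).i ∨
      h '' t.C (P j).i ⊆ h '' t.C (P i).i := fun i j =>
    (le_total (P i).i (P j).i).imp (fun hij => Set.image_mono (t.mono _ _ hij (P j).le_κ))
      (fun hij => Set.image_mono (t.mono _ _ hij (P i).le_κ))
  refine ⟨{
    i := σ
    n_le := hnσ.le
    le_κ := hσκ
    R := R
    D := D
    h := h
    N_le := p₀.N_le.trans (hRP p₀ hp₀)
    emb := hemb
    h_id := fun x hx => (hh p₀ hp₀ x (t.mono _ _ p₀.n_le p₀.le_κ hx)).symm.trans (p₀.h_id x hx)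
    str := fun j hnj hj => ?_
    mono := fun j l hnj hjl hl => ?_
    cont := fun j hnj hj hlim x hx => ?_
    bot := ?_
    top := hDσ _ (lt_irrefl σ)
    image_subset := fun j hnj hj => ?_
    fr_c := ?_
    fr_a := fun j hnj hj => ?_ }, fun p hp => ⟨⟨(hlt p hp).le, hRP p hp,
      fun j hnj hj => (hD p hp j hnj hj).symm, hh p hp⟩, hlt p hp⟩⟩
  · by_cases hjσ : j < σ
    · obtain ⟨p, hp, hjp⟩ := hex j hjσ
      rw [hD p hp j hnj hjp.le]
      exact (p.str j hnj hjp.le).up (hRP p hp)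
    · rw [hDσ j hjσ]
      exact str_carrier
  · by_cases hlσ : l < σ
    · obtain ⟨p, hp, hlp⟩ := hex l hlσ
      rw [hD p hp j hnj (hjl.trans hlp.le), hD p hp l (hnj.trans hjl) hlp.le]
      exact p.mono j l hnj hjl hlp.le
    · rw [hDσ l hlσ]
      by_cases hjσ : j < σ
      · obtain ⟨p, hp, hjp⟩ := hex j hjσ
        rw [hD p hp j hnj hjp.le]
        exact ((p.str j hnj hjp.le).up (hRP p hp)).subset
      · rw [hDσ j hjσ]
  · by_cases hjσ : j < σ
    · obtain ⟨p, hp, hjp⟩ := hex j hjσ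
      rw [hD p hp j hnj.le hjp.le] at hx
      obtain ⟨l, h1, h2, h3⟩ := p.cont j hnj hjp.le hlim x hx
      refine ⟨l, h1, h2, ?_⟩
      rwa [hD p hp l h1 (h2.le.trans hjp.le)]
    · rw [hDσ j hjσ, hR] at hx
      obtain ⟨l, hx⟩ := Set.mem_iUnion.1 hx
      refine ⟨(P (idx l)).i, (P _).n_le, ?_, ?_⟩
      · exact (hlt _ (hP _)).trans_le (not_lt.1 hjσ)
      · rwa [hD _ (hP _) _ (P _).n_le le_rfl, (P _).top]
  · rw [hD p₀ hp₀ n le_rfl p₀.n_le]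
    exact p₀.bot
  · by_cases hjσ : j < σ
    · obtain ⟨p, hp, hjp⟩ := hex j hjσ
      rw [hD p hp j hnj hjp.le, himg p hp j hjp.le]
      exact p.image_subset j hnj hjp.le
    · obtain rfl : j = σ := le_antisymm hj (not_lt.1 hjσ)
      rw [hDσ _ hjσ]
      rintro _ ⟨x, hx, rfl⟩
      obtain ⟨e, -, he⟩ := hemb
      have hStr := t.str _ hσκ
      have := he ⟨⟨x, hStr.subset hx⟩, hStr.mem_sub.2 hx⟩
      exact this ▸ (e _).2
  · have : Nonempty (Set.Iio σ) := ⟨⟨n, hnσ⟩⟩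
    rw [hCσ, Set.image_iUnion]
    refine fr_iUnion hs (fun j => ?_) htotC
    rw [himg _ (hP j) _ le_rfl]
    exact (P j).fr_c.up hs.pre (hRle' j)
  · obtain ⟨p, hp, hjp⟩ := hex j hj
    rw [hD p hp j hnj hjp.le, himg p hp j hjp.le, ← hh p hp _ (t.mono _ _
      (Order.succ_le_of_lt hjp) p.le_κ (t.mem j (hj.trans_le hσκ)))]
    exact (p.fr_a j hnj hjp).up hs.pre (hRP p hp)

/-- There is an approximation of full length. -/
theorem exists_full (hs : s.IsGoodMinusSt 2 lam) (hΩ : lam < #Ω) (hκ : κ.card ≤ lam) (hn : n ≤ κ)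
    (hc : Fr s t.N (t.C n) (t.C κ) c) : ∃ p : PartialExt t n c, p.i = κ := by
  let r : PartialExt t n c → PartialExt t n c → Prop := fun p q => p = q ∨ (p ≤ q ∧ p.i < q.i)
  have htrans : ∀ {p q q'}, r p q → r q q' → r p q' := by
    rintro p q q' (rfl | ⟨h1, h2⟩) (rfl | ⟨h3, h4⟩)
    · exact Or.inl rfl
    · exact Or.inr ⟨h3, h4⟩
    · exact Or.inr ⟨h1, h2⟩
    · exact Or.inr ⟨h1.trans h3, h2.trans h4⟩
  have hub : ∀ 𝒞, IsChain r 𝒞 → ∃ ub, ∀ p ∈ 𝒞, r p ub := by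
    intro 𝒞 h𝒞
    have hle : ∀ p ∈ 𝒞, ∀ q ∈ 𝒞, p.i ≤ q.i → r p q := fun p hp q hq hpq => by
      by_cases heq : p = q
      · exact Or.inl heq
      rcases h𝒞 hp hq heq with h | rfl | h
      · exact h
      · exact Or.inl rfl
      · exact absurd h.2 hpq.not_gt
    rcases 𝒞.eq_empty_or_nonempty with rfl | hne
    · exact (nonempty_of_fr hs hn hc).elim fun p => ⟨p, fun _ h => absurd h (Set.notMem_empty _)⟩
    by_cases hmax : ∀ p ∈ 𝒞, ∃ q ∈ 𝒞, p.i < q.i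
    · obtain ⟨q, hq⟩ := exists_limit hs hκ hne (fun p hp q hq hpq => by
        rcases hle p hp q hq hpq with rfl | h
        · exact le_rfl
        · exact h.1) hmax
      exact ⟨q, fun p hp => Or.inr (hq p hp)⟩
    · push Not at hmax
      obtain ⟨p, hp, hmax⟩ := hmax
      exact ⟨p, fun q hq => hle q hq p hp (hmax q hq)⟩
  obtain ⟨m, hm⟩ := exists_maximal_of_chains_bounded hub htrans
  refine ⟨m, m.le_κ.eq_of_not_lt fun hlt => ?_⟩
  obtain ⟨q, hmq, hi⟩ := exists_gt hs hΩ m hlt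
  rcases hm q (Or.inr ⟨hmq, hi⟩) with h | h
  · exact (h ▸ hi).ne rfl
  · exact (hi.trans h.2).ne rfl

end PartialExt

/-! ### Enlarging an independent chain to the whole ambient model -/

namespace IndepChain

open PartialExt

variable {s : FrameData K} {M : Set Ω} {a : Ordinal.{u} → Ω} {κ : Ordinal.{u}}

/-- An element free from `C κ` over `C n` can be caught by the last member of the chain, in some
extension of the whole chain. -/
theorem exists_ge_mem (hs : s.IsGoodMinusSt 2 lam) (hΩ : lam < #Ω) (hκ : κ.card ≤ lam)
    (t : IndepChain s lam M a κ) {n : Ordinal.{u}} (hn : n ≤ κ) (hlim : ¬ Order.IsSuccLimit n)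
    {c : Ω} (hc : Fr s t.N (t.C n) (t.C κ) c) : ∃ t', t ≤ t' ∧ c ∈ t'.C κ := by
  obtain ⟨p, hpκ⟩ := exists_full hs hΩ hκ hn hc
  have p_emb := p.emb
  have p_fr_c := p.fr_c
  have p_fr_a := p.fr_a
  have p_image_subset := p.image_subset
  have p_str := p.str
  have p_mono := p.mono
  have p_cont := p.cont
  rw [hpκ] at p_emb p_fr_c
  simp only [hpκ] at p_fr_a p_image_subset p_str p_mono p_cont
  have h0 := aleph0_le_of_LS hs.pre.ls_le
  obtain ⟨e, he, heh⟩ := p_emb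
  have hSκ := t.str κ le_rfl
  have hCn : t.C n ⊆ t.C κ := t.mono n κ hn le_rfl
  have hsub := PartialExt.sub_image_eq hSκ heh
  -- the copy of `C κ` in the new chain is identified with `C κ`, by uniqueness
  let V : L.Substructure (t.N.sub (t.C κ)) :=
    (t.N.sub (t.C n)).comap (t.N.sub (t.C κ)).subtype.toHom
  have hV : V.map (t.N.sub (t.C κ)).subtype.toHom = t.N.sub (t.C n) :=
    FrameData.map_comap_subtype (sub_mono hCn)
  have hfix : ∀ x : t.N.sub (t.C κ), (x : t.N.carrier) ∈ t.N.sub (t.C n) →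
      (e x : Ω) = (x : t.N.carrier) := fun x hx => by
    rw [heh, p.h_id _ (hc.left.mem_of_mem _ hx)]
  have hVe : V.map e.toHom = p.R.sub (t.C n) := by
    have h3 := hc.left.sub_img (incl p.N_le)
    rw [img_incl p.N_le hc.left.subset] at h3
    rw [h3, ← hV, ← FrameData.map_comp_eq]
    exact FrameData.map_congr fun x hx => Subtype.ext ((hfix x hx).trans (coe_incl _ _).symm)
  have h₁ : s.nf (V.map (t.N.sub (t.C κ)).subtype.toHom) (t.N.sub (t.C κ)).subtype.toHom.range
      (single (⟨c, hc.mem⟩ : t.N.carrier)) := by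
    rw [hV, Substructure.range_subtype]
    exact hc.nf
  have h₂ : s.nf (V.map e.toHom) e.toHom.range (single (⟨c, p_fr_c.mem⟩ : p.R.carrier)) := by
    rw [hVe, ← hsub]
    exact p_fr_c.nf
  obtain ⟨Q, _, f₁, f₂, hQ, hf₁, hf₂, hff, hfc⟩ := hs.joinable_of_nf (isEmb_subtype hSκ.strong) he
    h₁ h₂ ⟨p.R.carrier, inferInstance, incl p.N_le, Embedding.refl L _, p.R.mem, isEmb_incl _,
      isEmb_refl p.R.mem.1, fun x => Subtype.ext ((coe_incl _ _).trans (hfix _ x.2).symm),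
      Subtype.ext (coe_incl _ _)⟩
  obtain ⟨N', hNN', k, hk⟩ := exists_ge_equiv h0 hΩ t.N hQ hf₁
  let F : p.R.carrier ↪[L] N'.carrier := k.toEmbedding.comp f₂
  have hF : K.IsEmb F := isEmb_comp (isEmb_equiv k hQ.1) hf₂
  have hFc : (F ⟨c, p_fr_c.mem⟩ : Ω) = c := by
    have : F ⟨c, p_fr_c.mem⟩ = k (f₁ ⟨c, hc.mem⟩) := congrArg k hfc.symm
    rw [this, hk]
  have hFh : ∀ x (_ : x ∈ t.C κ) (hx' : p.h x ∈ p.R.carrier), (F ⟨p.h x, hx'⟩ : Ω) = x := by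
    intro x hx hx'
    have hxs : (⟨x, hSκ.subset hx⟩ : t.N.carrier) ∈ t.N.sub (t.C κ) :=
      (Str.mem_sub hSκ (x := ⟨x, hSκ.subset hx⟩)).2 hx
    have h1 : (⟨p.h x, hx'⟩ : p.R.carrier) = e ⟨_, hxs⟩ := Subtype.ext (heh ⟨_, hxs⟩).symm
    have h2 : F (e ⟨_, hxs⟩) = k (f₁ ⟨x, hSκ.subset hx⟩) := congrArg k (hff ⟨_, hxs⟩).symm
    rw [h1, h2, hk]
  have hsubD : ∀ j, n ≤ j → j ≤ κ → t.C j ⊆ img F (p.D j) := fun j hnj hj x hx => by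
    have h1 := p_image_subset j hnj hj ⟨x, hx, rfl⟩
    exact ⟨⟨p.h x, (p_str j hnj hj).subset h1⟩, h1, hFh x (t.mono j κ hj le_rfl hx) _⟩
  have himg : ∀ j ≤ κ, (p.h '' t.C j ⊆ p.R.carrier) → img F (p.h '' t.C j) = t.C j := by
    intro j hj hsubR
    ext y
    constructor
    · rintro ⟨⟨_, hxR⟩, ⟨x, hx, rfl⟩, rfl⟩
      rwa [hFh x (t.mono j κ hj le_rfl hx)]
    · intro hy
      exact ⟨⟨p.h y, hsubR ⟨y, hy, rfl⟩⟩, ⟨y, hy, rfl⟩, hFh y (t.mono j κ hj le_rfl hy) _⟩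
  classical
  let C' : Ordinal.{u} → Set Ω := fun j => if n ≤ j then img F (p.D j) else t.C j
  have hC'1 : ∀ j, n ≤ j → C' j = img F (p.D j) := fun j hj => if_pos hj
  have hC'2 : ∀ j, ¬ n ≤ j → C' j = t.C j := fun j hj => if_neg hj
  have hCC' : ∀ j ≤ κ, t.C j ⊆ C' j := fun j hj => by
    by_cases h : n ≤ j
    · rw [hC'1 j h]
      exact hsubD j h hj
    · rw [hC'2 j h]
  refine ⟨⟨N', C', fun j hj => ?_, fun i j hij hj => ?_, fun j hj hl x hx => ?_, fun j hj => ?_,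
    fun j hj => ?_⟩, ⟨hNN', hCC'⟩, ?_⟩
  · by_cases h : n ≤ j
    · rw [hC'1 j h]
      exact (p_str j h hj).img hF
    · rw [hC'2 j h]
      exact (t.str j hj).up hNN'
  · by_cases h : n ≤ i
    · rw [hC'1 i h, hC'1 j (h.trans hij)]
      exact img_mono (p_mono i j h hij hj)
    · rw [hC'2 i h]
      exact (t.mono i j hij hj).trans (hCC' j hj)
  · by_cases h : n ≤ j
    · rw [hC'1 j h] at hx
      obtain ⟨y, hy, rfl⟩ := hx
      have hnj : n < j := h.lt_of_ne fun h => hlim (h ▸ hl)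
      obtain ⟨l, h1, h2, h3⟩ := p_cont j hnj hj hl y hy
      exact ⟨l, h2, by rw [hC'1 l h1]; exact ⟨y, h3, rfl⟩⟩
    · rw [hC'2 j h] at hx
      obtain ⟨i, hi, hx⟩ := t.cont j hj hl x hx
      exact ⟨i, hi, hCC' i (hi.le.trans hj) hx⟩
  · exact hCC' _ (Order.succ_le_of_lt hj) (t.mem j hj)
  · have h1 := (t.fr j hj).up hs.pre hNN'
    by_cases h : n ≤ j
    · rw [hC'1 j h]
      have h2 := p_fr_a j h hj
      have h3 := h2.img hs.pre hF
      rw [himg j hj.le h2.left.subset,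
        hFh (a j) (t.mono _ _ (Order.succ_le_of_lt hj) le_rfl (t.mem j hj))] at h3
      exact h1.trans hs h3
    · rwa [hC'2 j h]
  · change c ∈ C' κ
    rw [hC'1 κ hn]
    exact ⟨⟨c, p_fr_c.mem⟩, p_mono n κ le_rfl hn le_rfl p.bot, hFc⟩

/-- Every independent chain of limit length has an extension whose last member is the
whole ambient model. -/
theorem exists_ge_eq (hs : s.IsGoodMinusSt 2 lam) (hΩ : lam < #Ω) (hκ : κ.card ≤ lam)
    (hlim : Order.IsSuccLimit κ) (t₀ : IndepChain s lam M a κ) :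
    ∃ t, t₀ ≤ t ∧ t.C κ = t.N.carrier := by
  have h0 := aleph0_le_of_LS hs.pre.ls_le
  obtain ⟨t, ht, hcl⟩ := exists_ge_closed h0 (fun t : IndepChain s lam M a κ => t.N.carrier)
    (fun t => t.C κ) (fun t t' (h : t ≤ t') => h.2 κ le_rfl) (fun t => t.N.mem.2.le)
    (fun ι _ f h1 h2 => exists_iUnion hs h1 f h2) t₀
  refine ⟨t, ht, ?_⟩
  by_contra hne
  have hSκ := t.str κ le_rfl
  have hT : K.IncrCont lam κ (fun j => t.N.sub (t.C j)) :=
    ⟨fun j hj => ⟨(t.str j hj).strong, (t.str j hj).card⟩,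
      fun i j hij hj => sub_mono (t.mono i j hij hj), fun j hj hl x => by
        constructor
        · intro hx
          obtain ⟨i, hi, hx⟩ := t.cont j hj hl x ((t.str j hj).mem_sub.1 hx)
          exact ⟨i, hi, (t.str i (hi.le.trans hj)).mem_sub.2 hx⟩
        · rintro ⟨i, hi, hx⟩
          exact sub_mono (t.mono i j hi.le hj) hx⟩
  obtain ⟨c, hc⟩ := hs.density t.N.carrier (t.N.sub (t.C κ)) hSκ.strong
    ⟨hSκ.strong, hSκ.card, t.N.mem.2⟩ (fun htop => hne (by
      refine hSκ.subset.antisymm fun x hx => hSκ.mem_of_mem ⟨x, hx⟩ ?_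
      rw [htop]
      trivial))
  obtain ⟨n, hn, hnf⟩ := hs.exists_nf_of_bs t.N.mem.2 hlim hT hc
  have hn1 : Order.succ n ≤ κ := (hlim.succ_lt hn).le
  have hfr : Fr s t.N (t.C n) (t.C κ) c := ⟨t.str n hn.le, hSκ, c.2, hnf⟩
  -- the level is raised to a successor, so that the new chain is still continuous
  have hfr' := hfr.mono hs.pre (t.str _ hn1) (t.mono _ _ (Order.le_succ n) hn1)
    (t.mono _ _ hn1 le_rfl)
  obtain ⟨t', ht', hct'⟩ := exists_ge_mem hs hΩ hκ t hn1 (Order.not_isSuccLimit_succ n) hfr'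
  exact hfr.notMem hs.pre (hcl t' ht' ⟨hct', c.2⟩)

end IndepChain

end

/-! ### Exchange and maximal independent sets -/

section

open AEC CMod

variable {L : FirstOrder.Language.{u, u}} {K : AEC L} {lam : Cardinal.{u}}

namespace FrameData

variable {s : FrameData K}

/-- Freeness inside a strong submodel `T`, phrased as in the definition of independence. -/
theorem IsPreFrame.nf_comap (hp : s.IsPreFrame 2 lam) {N : Type u} [L.Structure N]
    {S U T : L.Substructure N} {a : N} (H : s.nf S U (single a)) (hT : K.Strong N T) (hUT : U ≤ T)
    (ha : a ∈ T) : s.nf (S.comap T.subtype.toHom) (U.comap T.subtype.toHom)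
      (single (⟨a, ha⟩ : T)) := by
  have d := hp.nf_dom _ _ _ H
  refine hp.nf_of_map (isEmb_subtype hT) (mk_eq_of_between hUT d.2.1.2.1 d.1.2.2) ?_
  rw [map_comap_subtype (d.2.2.1.trans hUT), map_comap_subtype hUT]
  exact H

/-- The freeness clause of a witness of independence, computed in the ambient model. -/
theorem IndepWitness.nf (hp : s.IsPreFrame 2 lam) {N : Type u} [L.Structure N]
    {M M' : L.Substructure N} {β : Ordinal.{u}} {a : Seq β N}
    {C : Ordinal.{u} → L.Substructure N} (H : s.IndepWitness lam M M' a C) (i : Set.Iio β) :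
    a i ∈ C (Order.succ i.1) ∧ s.nf M (C i.1) (single (a i)) := by
  obtain ⟨hC, hM, hM', hMM', hM'C, hi⟩ := H
  obtain ⟨h, hnf⟩ := hi i
  have hs : Order.succ i.1 ≤ β := Order.succ_le_of_lt i.2
  have hle := hC.2.1 _ _ (Order.le_succ i.1) hs
  have h0 := hC.2.1 0 _ (zero_le (a := Order.succ i.1)) hs
  refine ⟨h, ?_⟩
  have := hp.nf_map hnf (isEmb_subtype (hC.1 _ hs).1) hM.2.2
  rwa [map_comap_subtype ((hMM'.trans hM'C).trans h0), map_comap_subtype hle] at this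

/-- Weight estimate: for an independent sequence of regular length `κ`, a set `X` of fewer than `κ`
elements is contained in a model from which some entry of the sequence is free. -/
theorem IsGoodMinusSt.exists_nf_of_mk_lt (hs : s.IsGoodMinusSt 2 lam) {N : Type u} [L.Structure N]
    {M M₀ : L.Substructure N} {β : Ordinal.{u}} {a : Seq β N} (ha : s.Indep lam M M₀ a)
    {κ : Cardinal.{u}} (hκ : κ.IsRegular) (hκβ : κ.ord ≤ β) (hκlam : κ ≤ lam) (X : Set N)
    (hX : #X < κ) :
    ∃ (i : Set.Iio β) (Q : Type u) (_ : L.Structure Q) (g : N ↪[L] Q) (B : L.Substructure Q),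
      K.IsEmb g ∧ (∀ x ∈ M₀, g x ∈ B) ∧ (∀ x ∈ X, g x ∈ B) ∧
      s.nf (M.map g.toHom) B (single (g (a i))) := by
  obtain ⟨hM, hM₀, hMM₀, N', _, g₀, C, hg₀, hw⟩ := ha
  have hN' : K.MemCard lam N' := ⟨hg₀.mem_right, hw.2.1.2.2⟩
  have hlim : Order.IsSuccLimit κ.ord := Cardinal.isSuccLimit_ord hκ.aleph0_le
  let Ω : Type u := (Order.succ lam).out
  have hΩ : lam < #Ω := by
    rw [Cardinal.mk_out]
    exact Order.lt_succ lam
  obtain ⟨φ⟩ : #N' ≤ #Ω := hN'.2.le.trans hΩ.le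
  obtain ⟨A, k, -, -⟩ := exists_of_injective hN' φ φ.injective
  have hk : K.IsEmb k.toEmbedding := isEmb_equiv k hN'.1
  let G : N ↪[L] A.carrier := k.toEmbedding.comp g₀
  have hG : K.IsEmb G := isEmb_comp hk hg₀
  have hβ0 : (0 : Ordinal.{u}) < β := hκ.ord_pos.trans_le hκβ
  classical
  let a' : Ordinal.{u} → Ω := fun j => if hj : j < β then G (a ⟨j, hj⟩) else G (a ⟨0, hβ0⟩)
  have ha' : ∀ j (hj : j < β), a' j = G (a ⟨j, hj⟩) := fun j hj => dif_pos hj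
  let C' : Ordinal.{u} → L.Substructure A.carrier := fun j => (C j).map k.toEmbedding.toHom
  let t₀ : IndepChain s lam (Subtype.val '' (M.map G.toHom : Set A.carrier)) a' κ.ord := {
    N := A
    C := fun j => Subtype.val '' (C' j : Set A.carrier)
    str := fun j hj => by
      have h1 := hw.1.1 j (hj.trans hκβ)
      exact str_image (Strong.map hk h1.1) ((mk_map _ _).trans h1.2)
    mono := fun i j hij hj =>
      Set.image_mono (Substructure.monotone_map (hw.1.2.1 i j hij (hj.trans hκβ)))
    cont := by
      rintro j hj hl _ ⟨_, ⟨y, hy, rfl⟩, rfl⟩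
      obtain ⟨i, hi, hy⟩ := (hw.1.2.2 j (hj.trans hκβ) hl y).1 hy
      exact ⟨i, hi, _, ⟨y, hy, rfl⟩, rfl⟩
    mem := fun j hj => by
      have hjβ := hj.trans_le hκβ
      rw [ha' j hjβ]
      exact ⟨_, ⟨_, (hw.nf hs.pre ⟨j, hjβ⟩).1, rfl⟩, rfl⟩
    fr := fun j hj => by
      have hjβ := hj.trans_le hκβ
      rw [ha' j hjβ, map_comp_eq]
      exact fr_of_nf hs.pre (hs.pre.nf_map (hw.nf hs.pre ⟨j, hjβ⟩).2 hk A.mem.2) }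
  obtain ⟨t, ⟨ht, htC⟩, htκ⟩ := t₀.exists_ge_eq hs hΩ ((Cardinal.card_ord κ).trans_le hκlam) hlim
  let g : N ↪[L] t.N.carrier := (incl ht).comp G
  have hgx : ∀ x, (g x : Ω) = G x := fun x => coe_incl ht _
  -- by regularity, the `< κ` elements of `X` lie in one member of the chain
  have hj : ∀ x : X, ∃ j < κ.ord, (g x : Ω) ∈ t.C j := fun x =>
    t.cont κ.ord le_rfl hlim _ (htκ.symm ▸ (g x).2)
  choose j hjκ hjx using hj
  have hsup : (⨆ x, j x) < κ.ord :=
    Ordinal.iSup_lt_of_lt_cof (by rwa [hκ.cof_ord]) hjκ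
  have hi := hsup.trans_le hκβ
  have hStr := t.str _ hsup.le
  have hM₁ : t.N.sub (Subtype.val '' (M.map G.toHom : Set A.carrier)) = M.map g.toHom := by
    have h1 : A.Str (Subtype.val '' (M.map G.toHom : Set A.carrier)) :=
      str_image (Strong.map hG hM.1) ((mk_map G M).trans hM.2.1)
    have h2 := h1.sub_img (incl ht)
    rw [img_incl ht h1.subset, sub_image] at h2
    exact h2.trans (map_comp_eq _ _ _).symm
  refine ⟨⟨_, hi⟩, t.N.carrier, inferInstance, g, t.N.sub (t.C (⨆ x, j x)),
    isEmb_comp (isEmb_incl ht) hG, fun x hx => ?_, fun x hx => ?_, ?_⟩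
  · refine hStr.mem_sub.2 (t.mono 0 _ zero_le hsup.le (htC 0 zero_le ?_))
    rw [hgx]
    exact ⟨_, ⟨g₀ x, hw.2.2.2.2.1 ⟨x, hx, rfl⟩, rfl⟩, rfl⟩
  · refine hStr.mem_sub.2 (t.mono (j ⟨x, hx⟩) _ ?_ hsup.le (hjx ⟨x, hx⟩))
    exact Ordinal.le_iSup j ⟨x, hx⟩
  · have h1 := (t.fr _ hsup).nf
    rw [hM₁] at h1
    convert h1 using 2
    exact Subtype.ext ((hgx _).trans (ha' _ hi).symm)

/-- The sequence `b` followed by `c`. -/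
noncomputable def snoc {N : Type u} {γ : Ordinal.{u}} (b : Seq γ N) (c : N) :
    Seq (Order.succ γ) N :=
  open Classical in fun i => if h : i.1 < γ then b ⟨i.1, h⟩ else c

theorem snoc_of_lt {N : Type u} {γ : Ordinal.{u}} (b : Seq γ N) (c : N)
    {i : Set.Iio (Order.succ γ)} (h : i.1 < γ) : snoc b c i = b ⟨i.1, h⟩ := dif_pos h

theorem snoc_of_not_lt {N : Type u} {γ : Ordinal.{u}} (b : Seq γ N) (c : N)
    {i : Set.Iio (Order.succ γ)} (h : ¬ i.1 < γ) : snoc b c i = c := dif_neg h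

theorem range_snoc {N : Type u} {γ : Ordinal.{u}} (b : Seq γ N) (c : N) :
    Set.range (snoc b c) = insert c (Set.range b) := by
  ext x
  constructor
  · rintro ⟨i, rfl⟩
    by_cases h : i.1 < γ
    · exact Or.inr ⟨_, (snoc_of_lt b c h).symm⟩
    · exact Or.inl (snoc_of_not_lt b c h)
  · rintro (rfl | ⟨i, rfl⟩)
    · exact ⟨⟨γ, Order.lt_succ γ⟩, snoc_of_not_lt b x (lt_irrefl γ)⟩
    · exact ⟨⟨i.1, i.2.trans (Order.lt_succ γ)⟩, snoc_of_lt b c i.2⟩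

/-- An independent sequence inside `B` can be prolonged by any element free from `B`. -/
theorem IsGoodMinusSt.indep_snoc (hs : s.IsGoodMinusSt 2 lam) {N : Type u} [L.Structure N]
    {M M₀ : L.Substructure N} {γ : Ordinal.{u}} {b : Seq γ N} (hb : s.Indep lam M M₀ b)
    {Q : Type u} [L.Structure Q] {g : N ↪[L] Q} (hg : K.IsEmb g) {B : L.Substructure Q}
    (hM₀B : ∀ x ∈ M₀, g x ∈ B) (hbB : ∀ i, g (b i) ∈ B) {c : N}
    (hc : s.nf (M.map g.toHom) B (single (g c))) : s.Indep lam M M₀ (snoc b c) := by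
  obtain ⟨hM, hM₀, hMM₀, N₂, _, g₂, E, hg₂, hw⟩ := hb
  have dc := hs.pre.nf_dom _ _ _ hc
  have hNmem : K.MemCard lam N := ⟨hg.mem_left, hM.2.2⟩
  obtain ⟨Q', _, q₁, q₂, hQ', hq₁, hq₂, hq⟩ := hs.amalgamation N Q N₂ g g₂ hNmem
    ⟨hg.mem_right, dc.1.2.2⟩ ⟨hg₂.mem_right, hw.2.1.2.2⟩ hg hg₂
  have h1 := hs.pre.nf_map hc hq₁ hQ'.2
  have d1 := hs.pre.nf_dom _ _ _ h1
  obtain ⟨R, _, f, k, hR, hf, hk, hfk, h2⟩ := hs.nf_extend h1 (isEmb_subtype d1.2.1.1) hQ'.2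
  let G : N ↪[L] R := f.comp (q₁.comp g)
  have hG : K.IsEmb G := isEmb_comp hf (isEmb_comp hq₁ hg)
  let k₂ : N₂ ↪[L] R := k.comp q₂
  have hk₂ : K.IsEmb k₂ := isEmb_comp hk hq₂
  have hGk : ∀ x, g x ∈ B → k₂ (g₂ x) = G x := fun x hx => by
    have h3 : f (q₁ (g x)) = k (q₁ (g x)) := hfk ⟨q₁ (g x), ⟨g x, hx, rfl⟩⟩
    change k (q₂ (g₂ x)) = f (q₁ (g x))
    rw [h3, hq]
  have hMG : (M.map g₂.toHom).map k₂.toHom = M.map G.toHom := by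
    rw [← map_comp_eq]
    exact map_congr fun x hx => hGk x (hM₀B x (hMM₀ hx))
  have h2' : s.nf (M.map G.toHom) k.toHom.range (single (G c)) := by
    rwa [← map_comp_eq, ← map_comp_eq] at h2
  classical
  let C : Ordinal.{u} → L.Substructure R := fun j => if j ≤ γ then (E j).map k₂.toHom else ⊤
  have hC1 : ∀ j, j ≤ γ → C j = (E j).map k₂.toHom := fun j hj => if_pos hj
  have hC2 : ∀ j, ¬ j ≤ γ → C j = ⊤ := fun j hj => if_neg hj
  have hM₀C : M₀.map G.toHom ≤ C 0 := by
    rw [hC1 0 zero_le]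
    rintro _ ⟨x, hx, rfl⟩
    exact ⟨g₂ x, hw.2.2.2.2.1 ⟨x, hx, rfl⟩, hGk x (hM₀B x hx)⟩
  have hCst : ∀ j, K.Strong R (C j) ∧ #(C j) = lam := fun j => by
    by_cases h : j ≤ γ
    · rw [hC1 j h]
      exact ⟨Strong.map hk₂ (hw.1.1 j h).1, (mk_map _ _).trans (hw.1.1 j h).2⟩
    · rw [hC2 j h]
      exact ⟨K.strong_top hR.1, Cardinal.mk_univ.trans hR.2⟩
  have hCmono : ∀ i j, i ≤ j → C i ≤ C j := fun i j hij => by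
    by_cases h : j ≤ γ
    · rw [hC1 j h, hC1 i (hij.trans h)]
      exact Substructure.monotone_map (hw.1.2.1 i j hij h)
    · rw [hC2 j h]
      exact le_top
  refine ⟨hM, hM₀, hMM₀, R, _, G, C, hG, ⟨fun j _ => hCst j, fun i j hij _ => hCmono i j hij,
    fun j hj hl x => ⟨fun hx => ?_, fun ⟨i, hi, hx⟩ => hCmono i j hi.le hx⟩⟩,
    StrongCard.map hG hR.2 hM, StrongCard.map hG hR.2 hM₀, Substructure.monotone_map hMM₀, hM₀C,
    fun i => ?_⟩
  · have hjγ : j ≤ γ := Order.lt_succ_iff.1 (hj.lt_of_ne fun h =>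
      Order.not_isSuccLimit_succ γ (h ▸ hl))
    rw [hC1 j hjγ] at hx
    obtain ⟨y, hy, rfl⟩ := hx
    obtain ⟨i, hi, hy⟩ := (hw.1.2.2 j hjγ hl y).1 hy
    exact ⟨i, hi, by rw [hC1 i (hi.le.trans hjγ)]; exact ⟨y, hy, rfl⟩⟩
  · have key : G (snoc b c i) ∈ C (Order.succ i.1) ∧
        s.nf (M.map G.toHom) (C i.1) (single (G (snoc b c i))) := by
      by_cases h : i.1 < γ
      · rw [snoc_of_lt b c h, hC1 _ (Order.succ_le_of_lt h), hC1 _ h.le, ← hMG,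
          ← hGk _ (hbB _)]
        have h3 := hw.nf hs.pre ⟨i.1, h⟩
        exact ⟨⟨_, h3.1, rfl⟩, hs.pre.nf_map h3.2 hk₂ hR.2⟩
      · have hi : i.1 = γ := le_antisymm (Order.lt_succ_iff.1 i.2) (not_lt.1 h)
        rw [snoc_of_not_lt b c h, hi, hC2 _ (Order.lt_succ γ).not_ge]
        refine ⟨Substructure.mem_top _, hs.pre.nf_mono h2' le_rfl ?_ ?_ ?_ (hCst γ).1⟩
        · exact (Substructure.monotone_map hMM₀).trans (hM₀C.trans (hCmono 0 γ zero_le))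
        · rw [hC1 γ le_rfl, map_comp_eq]
          exact Hom.map_le_range
        · exact Strong.map hG hM.1
    exact ⟨key.1, hs.pre.nf_comap key.2 (hCst _).1 (hCmono _ _ (Order.le_succ _)) key.1⟩

/-- A maximal independent set of realizations of types in `P` is at least as large as any infinite
independent set of such realizations. -/
theorem IsGoodMinusSt.mk_le_of_maximal (hs : s.IsGoodMinusSt 2 lam) {N : Type u} [L.Structure N]
    {M M₀ : L.Substructure N} {p : N → Prop} {I J : Set N}
    (hI : s.IndepSet lam M M₀ I) (hIp : ∀ x ∈ I, p x) (hinf : I.Infinite)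
    (hJ : Maximal (fun I : Set N => s.IndepSet lam M M₀ I ∧ ∀ x ∈ I, p x) J) : #I ≤ #J := by
  by_contra! hlt
  obtain ⟨κ, hκ, hJκ, hκI⟩ : ∃ κ : Cardinal.{u}, κ.IsRegular ∧ #J < κ ∧ κ ≤ #I := by
    rcases lt_or_ge #J ℵ₀ with h | h
    · exact ⟨ℵ₀, Cardinal.isRegular_aleph0, h, Cardinal.infinite_iff.1 hinf.to_subtype⟩
    · exact ⟨Order.succ #J, Cardinal.isRegular_succ h, Order.lt_succ _, Order.succ_le_of_lt hlt⟩
  obtain ⟨β, a, rfl, ha⟩ := hI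
  obtain ⟨⟨γ, b, hb, hbi⟩, hJp⟩ := hJ.prop
  have hcard : #(Set.range a) ≤ β.card := by
    have h1 := Cardinal.mk_range_le_lift (f := a)
    rw [Cardinal.mk_Iio_ordinal, Cardinal.lift_lift, Cardinal.lift_le] at h1
    exact h1
  have hκβ : κ.ord ≤ β := Cardinal.ord_le.2 (hκI.trans hcard)
  have hκlam : κ ≤ lam := hκI.trans (ha.1.2.2 ▸ Cardinal.mk_set_le _)
  obtain ⟨i, Q, _, g, B, hg, hM₀B, hJB, hnf⟩ := hs.exists_nf_of_mk_lt ha hκ hκβ hκlam J hJκ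
  have hind := hs.indep_snoc hbi hg hM₀B (fun j => hJB _ (hb ▸ ⟨j, rfl⟩)) hnf
  have hset : s.IndepSet lam M M₀ (insert (a i) J) :=
    ⟨_, _, by rw [range_snoc, hb], hind⟩
  have hmem : a i ∈ J := hJ.le_of_ge ⟨hset, by
    rintro x (rfl | hx)
    · exact hIp _ ⟨i, rfl⟩
    · exact hJp x hx⟩ (Set.subset_insert _ _) (Set.mem_insert _ _)
  exact hs.pre.notMem_of_nf hnf (hJB _ hmem)

end FrameData

end

theorem corollary5p1 {L : FirstOrder.Language.{u, u}} (K : AEC L) (s : FrameData K)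
    (lam : Cardinal.{u})
    (hs : s.IsGoodMinusSt 2 lam)
    (hsym : (s.elongation lam (Order.succ lam).ord).Symmetry (Order.succ lam).ord lam)
    (N : Type u) [L.Structure N] (M M₀ : L.Substructure N)
    (hM : K.StrongCard lam N M) (hM₀ : K.StrongCard lam N M₀) (hMM₀ : M ≤ M₀)
    (P : Set (K.GType M₀ 1)) (hP : P ⊆ s.bs M₀ 1)
    (I₁ I₂ : Set N)
    (hI₁ : Maximal (fun I : Set N => s.IndepSet lam M M₀ I ∧
      ∀ a ∈ I, AEC.tpIn hM₀.1 (AEC.single a) ∈ P) I₁)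
    (hI₂ : Maximal (fun I : Set N => s.IndepSet lam M M₀ I ∧
      ∀ a ∈ I, AEC.tpIn hM₀.1 (AEC.single a) ∈ P) I₂)
    (hinf : I₁.Infinite ∨ I₂.Infinite) :
    I₁.Infinite ∧ I₂.Infinite ∧ Cardinal.mk I₁ = Cardinal.mk I₂ := by
  have key : ∀ {I J : Set N},
      Maximal (fun I : Set N => s.IndepSet lam M M₀ I ∧
        ∀ a ∈ I, AEC.tpIn hM₀.1 (AEC.single a) ∈ P) I →
      Maximal (fun I : Set N => s.IndepSet lam M M₀ I ∧
        ∀ a ∈ I, AEC.tpIn hM₀.1 (AEC.single a) ∈ P) J →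
      I.Infinite → I.Infinite ∧ J.Infinite ∧ #I = #J := by
    intro I J hI hJ hinf
    have h1 := hs.mk_le_of_maximal hI.prop.1 hI.prop.2 hinf hJ
    have hJinf : J.Infinite := by
      rw [← Set.infinite_coe_iff, Cardinal.infinite_iff] at hinf ⊢
      exact hinf.trans h1
    exact ⟨hinf, hJinf, h1.antisymm (hs.mk_le_of_maximal hJ.prop.1 hJ.prop.2 hJinf hI)⟩
  rcases hinf with h | h
  · exact key hI₁ hI₂ h
  · obtain ⟨h2, h1, h⟩ := key hI₂ hI₁ h
    exact ⟨h1, h2, h.symm⟩
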